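/- Let $a=(a_\ell)_{\ell\in\mathbb Z}$ be a finitely supported complex sequence with $\sum_{\ell\in\mathbb Z}a_\ell=1$, and let $\widehat F_a(\theta):=\sum_{\ell\in\mathbb Z}a_\ell\,e^{i\ell\theta}$ for $\theta\in\mathbb C$. Assume that $|\widehat F_a(\theta)|<1$ for all real $\theta\in[-\pi,\pi]\setminus\{0\}$, and that there are real numbers $\alpha$, $c_3$, $c_4$ with $c_3>0$ and $c_4>0$ and a function $\varphi$, holomorphic on a neighborhood of $0$ in $\mathbb C$, such that, for all $\theta\in\mathbb C$ close to $0$, $$\widehat F_a(\theta)=\exp\left(i\alpha\theta-i c_3\theta^3-c_4\theta^4+\theta^5\varphi(\theta)\right).$$ Let $L_a$ be the convolution operator $(L_a u)_j:=\sum_{\ell\in\mathbb Z}a_\ell\,u_{j-\ell}$, let $\boldsymbol\delta$ be the sequence with $\boldsymbol\delta_0=1$ and $\boldsymbol\delta_j=0$ for $j\neq0$, and let $\mathcal G_j^n:=(L_a^n\boldsymbol\delta)_j$ for $n\in\mathbb N$, $j\in\mathbb Z$. Then $\sum_{j\in\mathbb Z}|\mathcal G_j^n|$ converges for every $n$, and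 $$\lim_{n\to+\infty}\frac{1}{n^{1/8}}\sum_{j\in\mathbb Z}\left|\mathcal G_j^n\right|=\frac{8\,\Gamma(11/8)}{\sqrt3\,\pi^{3/2}}\,\frac{c_3^{1/2}}{c_4^{3/8}}.$$ Consequently, the operator norm of $L_a^n$ on the Banach space $\ell^\infty(\mathbb Z;\mathbb C)$ of bounded sequences satisfies $$\lim_{n\to+\infty}\frac{1}{n^{1/8}}\left\|L_a^n\right\|_{\ell^\infty\to\ell^\infty}=\frac{8\,\Gamma(11/8)}{\sqrt3\,\pi^{3/2}}\,\frac{c_3^{1/2}}{c_4^{3/8}}.$$ -/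

import Mathlib

open scoped ENNReal

noncomputable section

/-- The Laurent (convolution) operator `L_a : u ↦ a ⋆ u` on complex sequences indexed by `ℤ`,
`(L_a u)_j = ∑_ℓ a_ℓ u_{j-ℓ}`, for a finitely supported sequence `a`. -/
def laurentOp (a : ℤ →₀ ℂ) : Module.End ℂ (ℤ → ℂ) where
  toFun u := fun j => ∑ l ∈ a.support, a l * u (j - l)
  map_add' u v := by
    funext j
    simp [mul_add, Finset.sum_add_distrib]
  map_smul' c u := by
    funext j
    simp only [Pi.smul_apply, smul_eq_mul, RingHom.id_apply, Finset.mul_sum]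
    exact Finset.sum_congr rfl fun l _ => by ring

/-- The discrete Dirac mass at `0`. -/
def diracSeq : ℤ → ℂ := fun j => if j = 0 then 1 else 0

/-- The Green's function `G_j^n = (L_a^n δ)_j`. -/
def greenFunction (a : ℤ →₀ ℂ) (n : ℕ) (j : ℤ) : ℂ := (laurentOp a ^ n) diracSeq j

/-- The Fourier transform `∑_ℓ a_ℓ e^{iℓθ}` of `a`, a trigonometric polynomial, for complex `θ`. -/
def fourierSymbol (a : ℤ →₀ ℂ) (θ : ℂ) : ℂ :=
  ∑ l ∈ a.support, a l * Complex.exp (Complex.I * (l : ℂ) * θ)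

/-- The standing assumption on a finitely supported sequence `a`: it sums to `1`, its Fourier
transform is dissipative, and the logarithm of the Fourier transform has the stated expansion at
`0`, with a holomorphic remainder. -/
structure DispersiveAssumption (a : ℤ →₀ ℂ) (α c₃ c₄ : ℝ) : Prop where
  sum_eq_one : ∑ l ∈ a.support, a l = 1
  dissipation : ∀ θ : ℝ, θ ∈ Set.Icc (-Real.pi) Real.pi → θ ≠ 0 → ‖fourierSymbol a (θ : ℂ)‖ < 1
  c₃_ne_zero : c₃ ≠ 0
  c₄_pos : 0 < c₄
  expansion : ∃ (φ : ℂ → ℂ) (U : Set ℂ), IsOpen U ∧ (0 : ℂ) ∈ U ∧ DifferentiableOn ℂ φ U ∧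
    ∀ θ ∈ U, fourierSymbol a θ =
      Complex.exp (Complex.I * (α : ℂ) * θ - Complex.I * (c₃ : ℂ) * θ ^ 3 - (c₄ : ℂ) * θ ^ 4
        + θ ^ 5 * φ θ)

theorem laurentOp_norm_le (a : ℤ →₀ ℂ) (u : lp (fun _ : ℤ => ℂ) ∞) (j : ℤ) :
    ‖laurentOp a (⇑u) j‖ ≤ (∑ l ∈ a.support, ‖a l‖) * ‖u‖ := by
  rw [Finset.sum_mul]
  refine (norm_sum_le _ _).trans (Finset.sum_le_sum fun l _ => ?_)
  rw [norm_mul]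
  exact mul_le_mul_of_nonneg_left (lp.norm_apply_le_norm ENNReal.top_ne_zero u _) (norm_nonneg _)

/-- The operator `L_a` acting boundedly on the Banach space `ℓ^∞(ℤ; ℂ)`. -/
def laurentLinfty (a : ℤ →₀ ℂ) :
    lp (fun _ : ℤ => ℂ) ∞ →L[ℂ] lp (fun _ : ℤ => ℂ) ∞ :=
  LinearMap.mkContinuous
    { toFun := fun u => ⟨laurentOp a (⇑u), memℓp_infty
        ⟨(∑ l ∈ a.support, ‖a l‖) * ‖u‖, by
          rintro _ ⟨j, rfl⟩
          exact laurentOp_norm_le a u j⟩⟩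
      map_add' := fun u v => by
        apply Subtype.ext
        exact (laurentOp a).map_add (⇑u) (⇑v)
      map_smul' := fun c u => by
        apply Subtype.ext
        exact (laurentOp a).map_smul c (⇑u) }
    (∑ l ∈ a.support, ‖a l‖)
    (fun u => lp.norm_le_of_forall_le
      (mul_nonneg (Finset.sum_nonneg fun _ _ => norm_nonneg _) (norm_nonneg _))
      (laurentOp_norm_le a u))

end

/-
The coefficient `𝒢ⁿ_j` is the `j`-th Fourier coefficient of `F̂ₐ ^ n`. On the scale
`l = n ^ (1 / 4)`, `z = (α n - j) / l ^ 2`, it is `(2πl)⁻¹` times the oscillatory integral of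
`exp (-c₄ θ⁴) * exp (i (l z θ - l c₃ θ³))`, up to `O(l ^ (-2))`. For `z < 0` the phase has no
stationary point and the integral is `O(l⁻¹)`. For `z > 0` there are two, `± √(z / (3 c₃))`, with
conjugate contributions, so the modulus of the integral is `l ^ (-1/2)` times
`profileAmp z * |cos (l * profilePhase z - π / 4)|`. Summing over the `≈ l ^ 2 dz` integers `j`
with `z` in a compact subset of `(0, ∞)` gives `l ^ (1/2)` times an integral in which `|cos|`
averages to `2 / π`. The remaining `j` (`z` near `0`, or `|z|` large) are controlled by
Cauchy–Schwarz, using Parseval for `𝒢ⁿ` and for `(j - α n) 𝒢ⁿ_j`.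
-/

noncomputable section

open MeasureTheory Set Filter Topology Asymptotics

open scoped Real ComplexConjugate NNReal

/-! ### Powers of the convolution operator -/

/-- The `n`-fold convolution power of a finitely supported sequence, taken in the group algebra
of `ℤ`. -/
def convPow (a : ℤ →₀ ℂ) (n : ℕ) : ℤ →₀ ℂ :=
  ((AddMonoidAlgebra.ofCoeff a : AddMonoidAlgebra ℂ ℤ) ^ n).coeff

/-- The action of `ℤ` on sequences by translation; it extends to the group algebra as
`laurentOp`. -/
def shiftHom : Multiplicative ℤ →* Module.End ℂ (ℤ → ℂ) where
  toFun m :=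
    { toFun := fun u j => u (j - m.toAdd)
      map_add' := fun _ _ => rfl
      map_smul' := fun _ _ => rfl }
  map_one' := by
    ext u j
    simp
  map_mul' m k := by
    refine LinearMap.ext fun u => funext fun j => ?_
    change u (j - (m.toAdd + k.toAdd)) = u (j - m.toAdd - k.toAdd)
    rw [sub_sub]

/-- The character `ℓ ↦ e^{iℓθ}` of `ℤ`; it extends to the group algebra as `fourierSymbol`. -/
def charHom (θ : ℂ) : Multiplicative ℤ →* ℂ where
  toFun m := Complex.exp (Complex.I * (m.toAdd : ℂ) * θ)
  map_one' := by simp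
  map_mul' m k := by
    rw [← Complex.exp_add]
    congr 1
    push_cast [toAdd_mul]
    ring

theorem laurentOp_eq_lift (a : ℤ →₀ ℂ) :
    laurentOp a = AddMonoidAlgebra.lift ℂ (Module.End ℂ (ℤ → ℂ)) ℤ shiftHom
      (AddMonoidAlgebra.ofCoeff a) := by
  rw [AddMonoidAlgebra.lift_apply]
  refine LinearMap.ext fun u => funext fun j => ?_
  simp only [Finsupp.sum, LinearMap.sum_apply, Finset.sum_apply]
  rfl

theorem fourierSymbol_eq_lift (a : ℤ →₀ ℂ) (θ : ℂ) :
    fourierSymbol a θ = AddMonoidAlgebra.lift ℂ ℂ ℤ (charHom θ) (AddMonoidAlgebra.ofCoeff a) := by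
  rw [AddMonoidAlgebra.lift_apply]
  rfl

theorem laurentOp_pow (a : ℤ →₀ ℂ) (n : ℕ) : laurentOp a ^ n = laurentOp (convPow a n) := by
  rw [laurentOp_eq_lift, laurentOp_eq_lift, ← map_pow, convPow, AddMonoidAlgebra.ofCoeff_coeff]

theorem fourierSymbol_convPow (a : ℤ →₀ ℂ) (n : ℕ) (θ : ℂ) :
    fourierSymbol (convPow a n) θ = fourierSymbol a θ ^ n := by
  rw [fourierSymbol_eq_lift, fourierSymbol_eq_lift, ← map_pow, convPow,
    AddMonoidAlgebra.ofCoeff_coeff]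

theorem laurentOp_diracSeq (b : ℤ →₀ ℂ) : laurentOp b diracSeq = b := by
  funext j
  change ∑ l ∈ b.support, b l * (if j - l = 0 then 1 else 0) = b j
  simp [sub_eq_zero, eq_comm]

theorem greenFunction_eq_convPow (a : ℤ →₀ ℂ) (n : ℕ) : greenFunction a n = convPow a n := by
  funext j
  rw [greenFunction, laurentOp_pow, laurentOp_diracSeq]

theorem tsum_norm_greenFunction (a : ℤ →₀ ℂ) (n : ℕ) :
    ∑' j : ℤ, ‖greenFunction a n j‖ = ∑ j ∈ (convPow a n).support, ‖convPow a n j‖ := by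
  rw [greenFunction_eq_convPow]
  exact tsum_eq_sum fun j hj => norm_eq_zero.mpr (Finsupp.notMem_support_iff.mp hj)

theorem summable_norm_greenFunction (a : ℤ →₀ ℂ) (n : ℕ) :
    Summable fun j : ℤ => ‖greenFunction a n j‖ := by
  rw [greenFunction_eq_convPow]
  exact summable_of_ne_finset_zero fun j hj => norm_eq_zero.mpr (Finsupp.notMem_support_iff.mp hj)

theorem coe_laurentLinfty_pow (a : ℤ →₀ ℂ) (n : ℕ) (u : lp (fun _ : ℤ => ℂ) ∞) :
    ⇑((laurentLinfty a ^ n) u) = (laurentOp a ^ n) u := by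
  induction n generalizing u with
  | zero => rfl
  | succ n ih =>
    rw [pow_succ, pow_succ]
    exact ih (laurentLinfty a u)

theorem laurentLinfty_pow (a : ℤ →₀ ℂ) (n : ℕ) :
    laurentLinfty a ^ n = laurentLinfty (convPow a n) := by
  refine ContinuousLinearMap.ext fun u => Subtype.ext ?_
  rw [coe_laurentLinfty_pow, laurentOp_pow]
  rfl

theorem norm_laurentLinfty (b : ℤ →₀ ℂ) : ‖laurentLinfty b‖ = ∑ l ∈ b.support, ‖b l‖ := by
  have hsum : 0 ≤ ∑ l ∈ b.support, ‖b l‖ := Finset.sum_nonneg fun _ _ => norm_nonneg _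
  refine le_antisymm (LinearMap.mkContinuous_norm_le _ hsum _) ?_
  -- The reflected complex signs of `b`; `0 / 0 = 0` off the support.
  let u : ℤ → ℂ := fun j => conj (b (-j)) / ‖b (-j)‖
  have hu (j : ℤ) : ‖u j‖ ≤ 1 := by
    simpa [u] using div_self_le_one ‖b (-j)‖
  let U : lp (fun _ : ℤ => ℂ) ∞ := ⟨u, memℓp_infty ⟨1, forall_mem_range.mpr hu⟩⟩
  have hterm (l : ℤ) : b l * u (0 - l) = ‖b l‖ := by
    simp only [u, zero_sub, neg_neg]
    rw [mul_div_assoc', Complex.mul_conj', sq, mul_self_div_self]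
  have hval : laurentOp b u 0 = ((∑ l ∈ b.support, ‖b l‖ : ℝ) : ℂ) := by
    push_cast
    exact Finset.sum_congr rfl fun l _ => hterm l
  calc ∑ l ∈ b.support, ‖b l‖ = ‖laurentOp b u 0‖ := by
        rw [hval, Complex.norm_real, Real.norm_of_nonneg hsum]
    _ ≤ ‖laurentLinfty b U‖ := lp.norm_apply_le_norm ENNReal.top_ne_zero (laurentLinfty b U) 0
    _ ≤ ‖laurentLinfty b‖ * ‖U‖ := (laurentLinfty b).le_opNorm U
    _ ≤ ‖laurentLinfty b‖ :=
        mul_le_of_le_one_right (norm_nonneg _) (lp.norm_le_of_forall_le zero_le_one hu)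

/-! ### Fourier coefficients and Parseval's identity -/

theorem continuous_fourierSymbol (b : ℤ →₀ ℂ) : Continuous (fourierSymbol b) := by
  unfold fourierSymbol
  fun_prop

theorem integral_exp_int_mul (m : ℤ) :
    ∫ θ in -π..π, Complex.exp (Complex.I * m * θ) = if m = 0 then 2 * (π : ℂ) else 0 := by
  split_ifs with hm
  · simp [hm, two_mul]
  · have hperiod : Complex.exp (Complex.I * m * π) = Complex.exp (Complex.I * m * (-π : ℝ)) :=
      Complex.exp_eq_exp_iff_exists_int.mpr ⟨m, by push_cast; ring⟩
    rw [integral_exp_mul_complex (by simp [hm]), hperiod, sub_self, zero_div]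

theorem integral_fourierSymbol_mul_exp (b : ℤ →₀ ℂ) (j : ℤ) :
    ∫ θ in -π..π, fourierSymbol b θ * Complex.exp (-(Complex.I * j * θ)) = 2 * π * b j := by
  have hexpand (θ : ℝ) : fourierSymbol b θ * Complex.exp (-(Complex.I * j * θ)) =
      ∑ l ∈ b.support, b l * Complex.exp (Complex.I * (l - j : ℤ) * θ) := by
    rw [fourierSymbol, Finset.sum_mul]
    refine Finset.sum_congr rfl fun l _ => ?_
    rw [mul_assoc, ← Complex.exp_add]
    push_cast
    ring_nf
  simp only [hexpand]
  rw [intervalIntegral.integral_finsetSum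
    fun l _ => (by fun_prop : Continuous _).intervalIntegrable _ _]
  simp only [intervalIntegral.integral_const_mul, integral_exp_int_mul, sub_eq_zero]
  simp [mul_comm]

theorem integral_norm_fourierSymbol_sq (b : ℤ →₀ ℂ) :
    ∫ θ in -π..π, ‖fourierSymbol b θ‖ ^ 2 = 2 * π * ∑ j ∈ b.support, ‖b j‖ ^ 2 := by
  have hexpand (θ : ℝ) : ((‖fourierSymbol b θ‖ ^ 2 : ℝ) : ℂ) = ∑ l ∈ b.support,
      conj (b l) * (fourierSymbol b θ * Complex.exp (-(Complex.I * l * θ))) := by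
    have hconj : conj (fourierSymbol b θ) =
        ∑ l ∈ b.support, conj (b l) * Complex.exp (-(Complex.I * l * θ)) := by
      simp [fourierSymbol, ← Complex.exp_conj]
    push_cast
    rw [← Complex.mul_conj', hconj, Finset.mul_sum]
    exact Finset.sum_congr rfl fun l _ => mul_left_comm _ _ _
  have hcont := continuous_fourierSymbol b
  apply Complex.ofReal_injective
  rw [← intervalIntegral.integral_ofReal]
  simp only [hexpand]
  rw [intervalIntegral.integral_finsetSum
    fun l _ => (by fun_prop : Continuous _).intervalIntegrable _ _]
  simp only [intervalIntegral.integral_const_mul, integral_fourierSymbol_mul_exp]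
  push_cast
  rw [Finset.mul_sum]
  exact Finset.sum_congr rfl fun l _ => by rw [← Complex.conj_mul', mul_left_comm]

theorem sum_norm_sq_le_of_norm_fourierSymbol_sq_le (b : ℤ →₀ ℂ) {G : ℝ → ℝ} (hG : Integrable G)
    (hG₀ : ∀ θ, 0 ≤ G θ) (hb : ∀ θ : ℝ, |θ| ≤ π → ‖fourierSymbol b θ‖ ^ 2 ≤ G θ) :
    ∑ j ∈ b.support, ‖b j‖ ^ 2 ≤ (2 * π)⁻¹ * ∫ θ, G θ := by
  have hcont := continuous_fourierSymbol b
  have hπ : -π ≤ π := neg_le_self Real.pi_pos.le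
  have hle : ∫ θ in -π..π, ‖fourierSymbol b θ‖ ^ 2 ≤ ∫ θ, G θ :=
    calc ∫ θ in -π..π, ‖fourierSymbol b θ‖ ^ 2 ≤ ∫ θ in -π..π, G θ :=
          intervalIntegral.integral_mono_on hπ
            ((by fun_prop : Continuous _).intervalIntegrable _ _) hG.intervalIntegrable
            fun θ hθ => hb θ (abs_le.mpr hθ)
      _ = ∫ θ in Ioc (-π) π, G θ := intervalIntegral.integral_of_le hπ
      _ ≤ ∫ θ, G θ := setIntegral_le_integral hG (ae_of_all _ hG₀)
  rwa [integral_norm_fourierSymbol_sq, ← le_inv_mul_iff₀ Real.two_pi_pos] at hle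

theorem hasDerivAt_fourierSymbol (b : ℤ →₀ ℂ) (θ : ℂ) :
    HasDerivAt (fourierSymbol b)
      (∑ l ∈ b.support, b l * (Complex.exp (Complex.I * l * θ) * (Complex.I * l))) θ := by
  refine HasDerivAt.fun_sum fun l _ => ?_
  simpa using (((hasDerivAt_id θ).const_mul (Complex.I * l)).cexp).const_mul (b l)

/-- The sequence `(j - x) b_j`, whose `ℓ²` norm measures the concentration of `b` around `x`. -/
def weightedSeq (b : ℤ →₀ ℂ) (x : ℝ) : ℤ →₀ ℂ :=
  Finsupp.onFinset b.support (fun j => ((j : ℂ) - x) * b j) fun _ hj =>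
    Finsupp.mem_support_iff.mpr (right_ne_zero_of_mul hj)

theorem fourierSymbol_weightedSeq (b : ℤ →₀ ℂ) (x : ℝ) (θ : ℂ) :
    fourierSymbol (weightedSeq b x) θ =
      -Complex.I * deriv (fourierSymbol b) θ - x * fourierSymbol b θ := by
  calc fourierSymbol (weightedSeq b x) θ
      = ∑ l ∈ b.support, ((l : ℂ) - x) * b l * Complex.exp (Complex.I * l * θ) :=
        Finsupp.sum_of_support_subset _ Finsupp.support_onFinset_subset
          (fun (l : ℤ) c => c * Complex.exp (Complex.I * l * θ)) (by simp)
    _ = -Complex.I * deriv (fourierSymbol b) θ - x * fourierSymbol b θ := by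
        rw [(hasDerivAt_fourierSymbol b θ).deriv, fourierSymbol, Finset.mul_sum, Finset.mul_sum,
          ← Finset.sum_sub_distrib]
        refine Finset.sum_congr rfl fun l _ => ?_
        linear_combination ((l : ℂ) * b l * Complex.exp (Complex.I * l * θ)) * Complex.I_mul_I

/-! ### Quartic Gaussian moments -/

theorem integrable_abs_pow_mul_exp_quartic {d : ℝ} (hd : 0 < d) (k : ℕ) :
    Integrable fun t : ℝ => |t| ^ k * Real.exp (-d * t ^ 4) := by
  have hgauss := (integrable_rpow_mul_exp_neg_mul_sq hd (s := (k : ℝ))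
    (neg_one_lt_zero.trans_le k.cast_nonneg)).norm.const_mul (Real.exp (d / 4))
  refine hgauss.mono' (by fun_prop) (ae_of_all _ fun t => ?_)
  rw [Real.norm_of_nonneg (by positivity), norm_mul, Real.rpow_natCast, norm_pow,
    Real.norm_eq_abs, Real.norm_of_nonneg (Real.exp_pos _).le, mul_left_comm, ← Real.exp_add]
  gcongr
  linarith [mul_nonneg hd.le (sq_nonneg (t ^ 2 - 1 / 2))]

/-- The absolute moments of the weight `exp (-d t⁴)`. -/
def quarticMoment (d : ℝ) (k : ℕ) : ℝ := ∫ t : ℝ, |t| ^ k * Real.exp (-d * t ^ 4)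

theorem abs_pow_mul_exp_quartic_scaled (d : ℝ) {l : ℝ} (hl : 0 < l) (k : ℕ) (t : ℝ) :
    |t| ^ k * Real.exp (-d * (l * t) ^ 4) =
      (l ^ k)⁻¹ * (|l * t| ^ k * Real.exp (-d * (l * t) ^ 4)) := by
  rw [abs_mul, abs_of_pos hl, mul_pow l |t|, mul_assoc, inv_mul_cancel_left₀ (by positivity)]

theorem integrable_abs_pow_mul_exp_quartic_scaled {d l : ℝ} (hd : 0 < d) (hl : 0 < l) (k : ℕ) :
    Integrable fun t : ℝ => |t| ^ k * Real.exp (-d * (l * t) ^ 4) := by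
  simp only [abs_pow_mul_exp_quartic_scaled d hl]
  exact ((integrable_abs_pow_mul_exp_quartic hd k).comp_mul_left' hl.ne').const_mul _

theorem integral_abs_pow_mul_exp_quartic_scaled (d : ℝ) {l : ℝ} (hl : 0 < l) (k : ℕ) :
    ∫ t : ℝ, |t| ^ k * Real.exp (-d * (l * t) ^ 4) = quarticMoment d k / l ^ (k + 1) := by
  simp only [abs_pow_mul_exp_quartic_scaled d hl]
  rw [integral_const_mul, Measure.integral_comp_mul_left
    (fun s => |s| ^ k * Real.exp (-d * s ^ 4)) l, abs_of_pos (inv_pos.mpr hl), smul_eq_mul,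
    quarticMoment, pow_succ, ← mul_assoc, ← mul_inv, ← div_eq_inv_mul]

/-! ### Bounds on the Fourier symbol -/

theorem exists_norm_le_mul_pow_of_isBigO {E : Type*} [SeminormedAddCommGroup E] {F : ℝ → E}
    (hF : Continuous F) {k : ℕ} (hO : F =O[𝓝 0] fun θ => θ ^ k) {K : Set ℝ} (hK : IsCompact K) :
    ∃ C, 0 ≤ C ∧ ∀ θ ∈ K, ‖F θ‖ ≤ C * |θ| ^ k := by
  obtain ⟨C, hC, hnear⟩ := hO.exists_pos
  obtain ⟨r, hr, hball⟩ := Metric.eventually_nhds_iff.mp hnear.bound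
  obtain ⟨B, hB⟩ := hK.exists_bound_of_continuousOn hF.continuousOn
  refine ⟨max C (B / r ^ k), hC.le.trans (le_max_left _ _), fun θ hθ => ?_⟩
  rcases lt_or_ge |θ| r with hθr | hθr
  · calc ‖F θ‖ ≤ C * |θ| ^ k := by simpa using hball (by simpa using hθr)
      _ ≤ max C (B / r ^ k) * |θ| ^ k := by gcongr; exact le_max_left _ _
  · have : 0 ≤ B := (norm_nonneg _).trans (hB θ hθ)
    calc ‖F θ‖ ≤ B / r ^ k * r ^ k := by
          rw [div_mul_cancel₀ _ (by positivity)]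
          exact hB θ hθ
      _ ≤ max C (B / r ^ k) * |θ| ^ k := by gcongr; exact le_max_right _ _

theorem exists_norm_le_mul_abs_pow_of_isBigO {F : ℂ → ℂ} (hF : Continuous F) {k : ℕ}
    (hO : F =O[𝓝 0] fun θ => θ ^ k) :
    ∃ C, 0 ≤ C ∧ ∀ θ : ℝ, |θ| ≤ π → ‖F θ‖ ≤ C * |θ| ^ k := by
  have hcoe : Tendsto (fun θ : ℝ => (θ : ℂ)) (𝓝 0) (𝓝 0) :=
    Complex.continuous_ofReal.tendsto' 0 0 rfl
  have hOreal : (fun θ : ℝ => F θ) =O[𝓝 0] fun θ => θ ^ k :=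
    (hO.comp_tendsto hcoe).trans (isBigO_of_le _ fun θ => by simp)
  obtain ⟨C, hC, hle⟩ := exists_norm_le_mul_pow_of_isBigO
    (hF.comp Complex.continuous_ofReal) hOreal (isCompact_Icc (a := -π) (b := π))
  exact ⟨C, hC, fun θ hθ => hle θ (abs_le.mp hθ)⟩

theorem exists_le_exp_quartic_of_lt_one {f : ℝ → ℝ} (hf : Continuous f) {K : Set ℝ}
    (hK : IsCompact K) (hlt : ∀ θ ∈ K, θ ≠ 0 → f θ < 1) {d : ℝ} (hd : 0 < d)
    (hnear : ∀ᶠ θ in 𝓝 0, f θ ≤ Real.exp (-d * θ ^ 4)) :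
    ∃ c, 0 < c ∧ c ≤ d ∧ ∀ θ ∈ K, f θ ≤ Real.exp (-c * θ ^ 4) := by
  obtain ⟨r, hr, hball⟩ := Metric.eventually_nhds_iff.mp hnear
  have hfar : IsCompact (K ∩ {θ | r ≤ |θ|}) :=
    hK.inter_right (isClosed_le continuous_const continuous_abs)
  -- Away from `0`, compactness gives room for the tangent line `1 - c θ⁴ ≤ exp (-c θ⁴)`.
  have hroom : ∃ c₁ > 0, ∀ θ ∈ K ∩ {θ | r ≤ |θ|}, c₁ * θ ^ 4 ≤ 1 - f θ := by
    rcases (K ∩ {θ | r ≤ |θ|}).eq_empty_or_nonempty with hempty | hne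
    · exact ⟨1, one_pos, by simp [hempty]⟩
    have hpos : ∀ θ ∈ K ∩ {θ | r ≤ |θ|}, 0 < θ ^ 4 := fun θ hθ =>
      Even.pow_pos (by decide) (abs_pos.mp (hr.trans_le hθ.2))
    obtain ⟨θ₀, hθ₀, hmin⟩ := hfar.exists_isMinOn hne
      (f := fun θ => (1 - f θ) / θ ^ 4)
      ((by fun_prop : Continuous fun θ => 1 - f θ).continuousOn.div (by fun_prop)
        fun θ hθ => (hpos θ hθ).ne')
    refine ⟨(1 - f θ₀) / θ₀ ^ 4, div_pos (sub_pos.mpr (hlt θ₀ hθ₀.1 ?_)) (hpos θ₀ hθ₀),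
      fun θ hθ => (le_div_iff₀ (hpos θ hθ)).mp (hmin hθ)⟩
    exact abs_pos.mp (hr.trans_le hθ₀.2)
  obtain ⟨c₁, hc₁, hfar_le⟩ := hroom
  refine ⟨min d c₁, lt_min hd hc₁, min_le_left _ _, fun θ hθ => ?_⟩
  rcases lt_or_ge |θ| r with hθr | hθr
  · refine (hball (by simpa using hθr)).trans ?_
    gcongr
    exact min_le_left _ _
  · calc f θ ≤ -c₁ * θ ^ 4 + 1 := by linarith [hfar_le θ ⟨hθ, hθr⟩]
      _ ≤ -min d c₁ * θ ^ 4 + 1 := by gcongr; exact min_le_right _ _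
      _ ≤ Real.exp (-min d c₁ * θ ^ 4) := Real.add_one_le_exp _

/-- The leading part of the Fourier symbol near the origin. -/
def modelSymbol (α c₃ c₄ : ℝ) (θ : ℂ) : ℂ :=
  Complex.exp (Complex.I * α * θ - Complex.I * c₃ * θ ^ 3 - c₄ * θ ^ 4)

theorem continuous_modelSymbol (α c₃ c₄ : ℝ) : Continuous (modelSymbol α c₃ c₄) := by
  unfold modelSymbol
  fun_prop

theorem norm_modelSymbol (α c₃ c₄ θ : ℝ) :
    ‖modelSymbol α c₃ c₄ θ‖ = Real.exp (-c₄ * θ ^ 4) := by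
  rw [modelSymbol, Complex.norm_exp]
  simp [← Complex.ofReal_pow]

namespace DispersiveAssumption

variable {a : ℤ →₀ ℂ} {α c₃ c₄ : ℝ}

theorem exists_eventuallyEq (ha : DispersiveAssumption a α c₃ c₄) :
    ∃ φ : ℂ → ℂ, AnalyticAt ℂ φ 0 ∧
      fourierSymbol a =ᶠ[𝓝 0] fun θ => modelSymbol α c₃ c₄ θ * Complex.exp (θ ^ 5 * φ θ) := by
  obtain ⟨φ, U, hU, h₀, hφ, hexp⟩ := ha.expansion
  refine ⟨φ, hφ.analyticAt (hU.mem_nhds h₀), ?_⟩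
  filter_upwards [hU.mem_nhds h₀] with θ hθ
  rw [hexp θ hθ, modelSymbol, ← Complex.exp_add]

theorem isBigO_sub_modelSymbol (ha : DispersiveAssumption a α c₃ c₄) :
    (fun θ => fourierSymbol a θ - modelSymbol α c₃ c₄ θ) =O[𝓝 0] fun θ => θ ^ 5 := by
  obtain ⟨φ, hφ, hexp⟩ := ha.exists_eventuallyEq
  have hφc : ContinuousAt φ 0 := hφ.continuousAt
  have hrem : (fun θ => Complex.exp (θ ^ 5 * φ θ) - 1) =O[𝓝 0] fun θ => θ ^ 5 * φ θ := by
    have htend : Tendsto (fun θ => θ ^ 5 * φ θ) (𝓝 0) (𝓝 0) := by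
      simpa using (by fun_prop : ContinuousAt (fun θ => θ ^ 5 * φ θ) 0).tendsto
    simpa [Function.comp_def] using
      (Complex.hasDerivAt_exp 0).isBigO_sub.comp_tendsto htend
  have hfactor : (fun θ => fourierSymbol a θ - modelSymbol α c₃ c₄ θ) =ᶠ[𝓝 0]
      fun θ => modelSymbol α c₃ c₄ θ * (Complex.exp (θ ^ 5 * φ θ) - 1) := by
    filter_upwards [hexp] with θ hθ
    rw [hθ, mul_sub_one]
  have hmodel := ((continuous_modelSymbol α c₃ c₄).tendsto 0).isBigO_one ℂ
  have hφ_one := hφc.tendsto.isBigO_one ℂ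
  simpa using (hfactor.isBigO.trans (hmodel.mul hrem)).trans
    ((isBigO_refl _ _).mul ((isBigO_refl (fun θ : ℂ => θ ^ 5) _).mul hφ_one))

theorem isBigO_weightedSeq (ha : DispersiveAssumption a α c₃ c₄) :
    fourierSymbol (weightedSeq a α) =O[𝓝 0] fun θ => θ ^ 2 := by
  obtain ⟨φ, hφ, hexp⟩ := ha.exists_eventuallyEq
  let ψ : ℂ → ℂ := fun θ => -(Complex.I * c₃) - c₄ * θ + θ ^ 2 * φ θ
  have hψ : AnalyticAt ℂ ψ 0 := by fun_prop
  have hform : fourierSymbol a =ᶠ[𝓝 0] fun θ => Complex.exp (Complex.I * α * θ + θ ^ 3 * ψ θ) := by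
    filter_upwards [hexp] with θ hθ
    rw [hθ, modelSymbol, ← Complex.exp_add]
    congr 1
    ring
  -- The linear phase is cancelled by the shift of the weight, so only `θ ^ 3 * ψ θ` is felt.
  have hderiv : fourierSymbol (weightedSeq a α) =ᶠ[𝓝 0] fun θ =>
      θ ^ 2 * (-Complex.I * fourierSymbol a θ * (3 * ψ θ + θ * deriv ψ θ)) := by
    filter_upwards [hform.eventuallyEq_nhds, hψ.eventually_analyticAt] with θ hθ hψθ
    have hd := (((hasDerivAt_id θ).const_mul (Complex.I * α)).add
      ((hasDerivAt_pow 3 θ).mul hψθ.differentiableAt.hasDerivAt)).cexp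
    have hd' : deriv (fourierSymbol a) θ = fourierSymbol a θ *
        (Complex.I * α * 1 + (3 * θ ^ 2 * ψ θ + θ ^ 3 * deriv ψ θ)) := by
      rw [hθ.eq_of_nhds]
      exact (hd.congr_of_eventuallyEq hθ).deriv
    rw [fourierSymbol_weightedSeq, hd']
    linear_combination (-(α : ℂ) * fourierSymbol a θ) * Complex.I_mul_I
  have hcofactor : ContinuousAt
      (fun θ => -Complex.I * fourierSymbol a θ * (3 * ψ θ + θ * deriv ψ θ)) 0 := by
    have := (continuous_fourierSymbol a).continuousAt (x := 0)
    have := hψ.continuousAt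
    have := hψ.deriv.continuousAt
    fun_prop
  simpa using hderiv.isBigO.trans
    ((isBigO_refl (fun θ : ℂ => θ ^ 2) _).mul (hcofactor.tendsto.isBigO_one ℂ))

theorem eventually_norm_fourierSymbol_le (ha : DispersiveAssumption a α c₃ c₄) :
    ∀ᶠ θ : ℝ in 𝓝 0, ‖fourierSymbol a θ‖ ≤ Real.exp (-(c₄ / 2) * θ ^ 4) := by
  obtain ⟨φ, hφ, hexp⟩ := ha.exists_eventuallyEq
  have hcoe : Tendsto (fun θ : ℝ => (θ : ℂ)) (𝓝 0) (𝓝 0) :=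
    Complex.continuous_ofReal.tendsto' 0 0 rfl
  have hsmall : ∀ᶠ θ : ℂ in 𝓝 0, ‖θ * φ θ‖ < c₄ / 2 := by
    have : ContinuousAt (fun θ => ‖θ * φ θ‖) 0 := (continuousAt_id.mul hφ.continuousAt).norm
    exact this.eventually_lt_const (by simpa using ha.c₄_pos)
  filter_upwards [hcoe.eventually hexp, hcoe.eventually hsmall] with θ hθ hθφ
  rw [hθ, norm_mul, norm_modelSymbol, Complex.norm_exp, ← Real.exp_add, Real.exp_le_exp]
  have hre : ((θ : ℂ) ^ 5 * φ θ).re ≤ c₄ / 2 * θ ^ 4 :=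
    calc ((θ : ℂ) ^ 5 * φ θ).re ≤ ‖(θ : ℂ) ^ 4 * (θ * φ θ)‖ := by
          rw [← mul_assoc, ← pow_succ]
          exact Complex.re_le_norm _
      _ = ‖(θ : ℂ) * φ θ‖ * θ ^ 4 := by
          rw [norm_mul, ← Complex.ofReal_pow, Complex.norm_of_nonneg (by positivity), mul_comm]
      _ ≤ c₄ / 2 * θ ^ 4 := by gcongr
  linarith

theorem exists_norm_fourierSymbol_le (ha : DispersiveAssumption a α c₃ c₄) :
    ∃ c, 0 < c ∧ c ≤ c₄ ∧ ∀ θ : ℝ, |θ| ≤ π → ‖fourierSymbol a θ‖ ≤ Real.exp (-c * θ ^ 4) := by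
  obtain ⟨c, hc, hcc₄, hle⟩ := exists_le_exp_quartic_of_lt_one
    ((continuous_fourierSymbol a).comp Complex.continuous_ofReal).norm
    (isCompact_Icc (a := -π) (b := π)) ha.dissipation (half_pos ha.c₄_pos)
    ha.eventually_norm_fourierSymbol_le
  exact ⟨c, hc, hcc₄.trans (half_le_self ha.c₄_pos.le), fun θ hθ => hle θ (abs_le.mp hθ)⟩

end DispersiveAssumption

/-! ### The Green's function in mean square -/

theorem exp_quartic_pow_eq {n : ℕ} {l : ℝ} (hl : l ^ 4 = n) (c θ : ℝ) :
    Real.exp (-c * θ ^ 4) ^ n = Real.exp (-c * (l * θ) ^ 4) := by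
  rw [← Real.exp_nat_mul, mul_pow l, hl, mul_left_comm]

theorem exp_quartic_pow_pred_le {c : ℝ} (hc : 0 ≤ c) {n : ℕ} (hn : 2 ≤ n) {l : ℝ}
    (hl : l ^ 4 = n) (θ : ℝ) :
    Real.exp (-c * θ ^ 4) ^ (n - 1) ≤ Real.exp (-(c / 2) * (l * θ) ^ 4) := by
  have hhalf : (n : ℝ) / 2 ≤ (n - 1 : ℕ) := by
    have : (2 : ℝ) ≤ n := mod_cast hn
    rw [Nat.cast_pred (by lia)]
    linarith
  have hcθ : 0 ≤ c * θ ^ 4 := by positivity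
  rw [← Real.exp_nat_mul, mul_pow, hl, Real.exp_le_exp]
  linarith [mul_le_mul_of_nonneg_right hhalf hcθ]

section

variable {a : ℤ →₀ ℂ} {α c₃ c₄ c C l : ℝ} {n : ℕ}

theorem sum_norm_sq_convPow_le (hc : 0 < c)
    (hdecay : ∀ θ : ℝ, |θ| ≤ π → ‖fourierSymbol a θ‖ ≤ Real.exp (-c * θ ^ 4))
    (hl₀ : 0 < l) (hl : l ^ 4 = n) :
    ∑ j ∈ (convPow a n).support, ‖convPow a n j‖ ^ 2 ≤ (2 * π)⁻¹ * (quarticMoment c 0 / l) := by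
  calc ∑ j ∈ (convPow a n).support, ‖convPow a n j‖ ^ 2
      ≤ (2 * π)⁻¹ * ∫ θ, |θ| ^ 0 * Real.exp (-c * (l * θ) ^ 4) := by
        refine sum_norm_sq_le_of_norm_fourierSymbol_sq_le _
          (integrable_abs_pow_mul_exp_quartic_scaled hc hl₀ 0) (fun θ => by positivity)
          fun θ hθ => ?_
        have hexp : Real.exp (-c * (l * θ) ^ 4) ≤ 1 :=
          Real.exp_le_one_iff.mpr (by rw [neg_mul, neg_nonpos]; positivity)
        rw [fourierSymbol_convPow, norm_pow, pow_zero, one_mul]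
        calc (‖fourierSymbol a θ‖ ^ n) ^ 2 ≤ (Real.exp (-c * θ ^ 4) ^ n) ^ 2 := by
              gcongr
              exact hdecay θ hθ
          _ = Real.exp (-c * (l * θ) ^ 4) ^ 2 := by rw [exp_quartic_pow_eq hl]
          _ ≤ Real.exp (-c * (l * θ) ^ 4) :=
              pow_le_of_le_one (Real.exp_pos _).le hexp two_ne_zero
    _ = (2 * π)⁻¹ * (quarticMoment c 0 / l) := by
        rw [integral_abs_pow_mul_exp_quartic_scaled c hl₀, zero_add, pow_one]

theorem fourierSymbol_weightedSeq_convPow (a : ℤ →₀ ℂ) (α : ℝ) (n : ℕ) (θ : ℂ) :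
    fourierSymbol (weightedSeq (convPow a n) (α * n)) θ =
      n * fourierSymbol a θ ^ (n - 1) * fourierSymbol (weightedSeq a α) θ := by
  have hsymbol : fourierSymbol (convPow a n) = fun z => fourierSymbol a z ^ n :=
    funext fun z => fourierSymbol_convPow a n z
  have hderiv := (hasDerivAt_fourierSymbol a θ).differentiableAt.hasDerivAt.fun_pow n
  rw [fourierSymbol_weightedSeq, fourierSymbol_weightedSeq, hsymbol, hderiv.deriv]
  rcases n with _ | n
  · simp
  · push_cast
    ring

theorem norm_weightedSeq_apply_sq (b : ℤ →₀ ℂ) (x : ℝ) (j : ℤ) :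
    ‖weightedSeq b x j‖ ^ 2 = ((j : ℝ) - x) ^ 2 * ‖b j‖ ^ 2 := by
  rw [weightedSeq, Finsupp.onFinset_apply, norm_mul, mul_pow, ← Complex.ofReal_intCast,
    ← Complex.ofReal_sub, Complex.norm_real, Real.norm_eq_abs, sq_abs]

theorem sum_norm_sq_weightedSeq (b : ℤ →₀ ℂ) (x : ℝ) :
    ∑ j ∈ (weightedSeq b x).support, ‖weightedSeq b x j‖ ^ 2 =
      ∑ j ∈ b.support, ((j : ℝ) - x) ^ 2 * ‖b j‖ ^ 2 := by
  simp only [← norm_weightedSeq_apply_sq]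
  exact Finset.sum_subset Finsupp.support_onFinset_subset fun j _ hj => by
    rw [Finsupp.notMem_support_iff.mp hj, norm_zero, zero_pow two_ne_zero]

theorem norm_fourierSymbol_weightedSeq_convPow_sq_le (hc : 0 ≤ c)
    (hdecay : ∀ θ : ℝ, |θ| ≤ π → ‖fourierSymbol a θ‖ ≤ Real.exp (-c * θ ^ 4))
    (hweight : ∀ θ : ℝ, |θ| ≤ π → ‖fourierSymbol (weightedSeq a α) θ‖ ≤ C * |θ| ^ 2)
    (hn : 2 ≤ n) (hl : l ^ 4 = n) {θ : ℝ} (hθ : |θ| ≤ π) :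
    ‖fourierSymbol (weightedSeq (convPow a n) (α * n)) θ‖ ^ 2 ≤
      l ^ 8 * C ^ 2 * (|θ| ^ 4 * Real.exp (-(c / 2) * (l * θ) ^ 4)) := by
  set e : ℝ := Real.exp (-(c / 2) * (l * θ) ^ 4)
  have he : e ≤ 1 := Real.exp_le_one_iff.mpr (by rw [neg_mul, neg_nonpos]; positivity)
  have hpow : ‖fourierSymbol a θ‖ ^ (n - 1) ≤ e :=
    (pow_le_pow_left₀ (norm_nonneg _) (hdecay θ hθ) _).trans (exp_quartic_pow_pred_le hc hn hl θ)
  rw [fourierSymbol_weightedSeq_convPow, norm_mul, norm_mul, norm_pow, Complex.norm_natCast, ← hl]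
  calc (l ^ 4 * ‖fourierSymbol a θ‖ ^ (n - 1) * ‖fourierSymbol (weightedSeq a α) θ‖) ^ 2
      ≤ (l ^ 4 * e * (C * |θ| ^ 2)) ^ 2 := by gcongr; exact hweight θ hθ
    _ = l ^ 8 * C ^ 2 * (|θ| ^ 4 * e ^ 2) := by ring
    _ ≤ l ^ 8 * C ^ 2 * (|θ| ^ 4 * e) := by
        gcongr
        exact pow_le_of_le_one (Real.exp_pos _).le he two_ne_zero

theorem sum_sq_mul_norm_sq_convPow_le (hc : 0 < c)
    (hdecay : ∀ θ : ℝ, |θ| ≤ π → ‖fourierSymbol a θ‖ ≤ Real.exp (-c * θ ^ 4))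
    (hweight : ∀ θ : ℝ, |θ| ≤ π → ‖fourierSymbol (weightedSeq a α) θ‖ ≤ C * |θ| ^ 2)
    (hn : 2 ≤ n) (hl₀ : 0 < l) (hl : l ^ 4 = n) :
    ∑ j ∈ (convPow a n).support, ((j : ℝ) - α * n) ^ 2 * ‖convPow a n j‖ ^ 2 ≤
      (2 * π)⁻¹ * (C ^ 2 * quarticMoment (c / 2) 4 * l ^ 3) := by
  rw [← sum_norm_sq_weightedSeq]
  refine (sum_norm_sq_le_of_norm_fourierSymbol_sq_le _
    ((integrable_abs_pow_mul_exp_quartic_scaled (half_pos hc) hl₀ 4).const_mul (l ^ 8 * C ^ 2))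
    (fun θ => by positivity) fun θ hθ =>
      norm_fourierSymbol_weightedSeq_convPow_sq_le hc.le hdecay hweight hn hl hθ).trans_eq ?_
  rw [integral_const_mul, integral_abs_pow_mul_exp_quartic_scaled _ hl₀]
  field_simp
  ring

end

/-! ### The Green's function as an oscillatory integral -/

/-- The phase `l (c₃ t³ - z t)`: `l = n ^ (1/4)` is large, and `z` is the rescaled distance to the
centre of the Green's function. -/
def cubicPhase (c₃ l z t : ℝ) : ℝ := l * (c₃ * t ^ 3 - z * t)

/-- The integrand `exp (-c₄ t⁴ - i l (c₃ t³ - z t))` of the limiting oscillatory integral. -/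
def oscKernel (c₃ c₄ l z t : ℝ) : ℂ :=
  Real.exp (-c₄ * t ^ 4) * Complex.exp (-(Complex.I * cubicPhase c₃ l z t))

/-- The oscillatory integral that approximates the rescaled Green's function. -/
def oscInt (c₃ c₄ l z : ℝ) : ℂ := ∫ t, oscKernel c₃ c₄ l z t

theorem continuous_oscKernel (c₃ c₄ l z : ℝ) : Continuous (oscKernel c₃ c₄ l z) := by
  unfold oscKernel cubicPhase
  fun_prop

theorem norm_exp_neg_I_mul (x : ℝ) : ‖Complex.exp (-(Complex.I * x))‖ = 1 := by
  rw [← mul_neg, ← Complex.ofReal_neg, Complex.norm_exp_I_mul_ofReal]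

theorem norm_oscKernel (c₃ c₄ l z t : ℝ) :
    ‖oscKernel c₃ c₄ l z t‖ = Real.exp (-c₄ * t ^ 4) := by
  rw [oscKernel, norm_mul, norm_exp_neg_I_mul, mul_one, Complex.norm_real, Real.norm_eq_abs,
    Real.abs_exp]

theorem integrable_oscKernel {c₄ : ℝ} (hc₄ : 0 < c₄) (c₃ l z : ℝ) :
    Integrable (oscKernel c₃ c₄ l z) := by
  refine (integrable_abs_pow_mul_exp_quartic hc₄ 0).mono'
    (continuous_oscKernel _ _ _ _).aestronglyMeasurable (ae_of_all _ fun t => ?_)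
  rw [norm_oscKernel, pow_zero, one_mul]

section

variable {a : ℤ →₀ ℂ} {α c₃ c₄ c C l : ℝ} {n : ℕ}

theorem modelSymbol_pow_mul_exp (α c₃ c₄ : ℝ) (hl₀ : 0 < l) (hl : l ^ 4 = n) (j : ℤ) (θ : ℝ) :
    modelSymbol α c₃ c₄ θ ^ n * Complex.exp (-(Complex.I * j * θ)) =
      oscKernel c₃ c₄ l ((α * n - j) / l ^ 2) (l * θ) := by
  have hl' : (l : ℂ) ^ 4 = n := mod_cast hl
  have hl₀' : (l : ℂ) ≠ 0 := mod_cast hl₀.ne'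
  rw [modelSymbol, oscKernel, cubicPhase, Complex.ofReal_exp, ← Complex.exp_nat_mul,
    ← Complex.exp_add, ← Complex.exp_add, ← hl', ← hl]
  congr 1
  push_cast
  field_simp
  ring

theorem integrable_modelSymbol_pow_mul_exp (α c₃ : ℝ) (hc₄ : 0 < c₄) (hl₀ : 0 < l)
    (hl : l ^ 4 = n) (j : ℤ) :
    Integrable fun θ : ℝ => modelSymbol α c₃ c₄ θ ^ n * Complex.exp (-(Complex.I * j * θ)) := by
  simp only [modelSymbol_pow_mul_exp α c₃ c₄ hl₀ hl]
  exact (integrable_oscKernel hc₄ _ _ _).comp_mul_left' hl₀.ne'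

theorem integral_modelSymbol_pow_mul_exp (α c₃ c₄ : ℝ) (hl₀ : 0 < l) (hl : l ^ 4 = n) (j : ℤ) :
    ∫ θ : ℝ, modelSymbol α c₃ c₄ θ ^ n * Complex.exp (-(Complex.I * j * θ)) =
      (l : ℂ)⁻¹ * oscInt c₃ c₄ l ((α * n - j) / l ^ 2) := by
  simp only [modelSymbol_pow_mul_exp α c₃ c₄ hl₀ hl]
  rw [Measure.integral_comp_mul_left (oscKernel c₃ c₄ l ((α * n - j) / l ^ 2)) l, oscInt,
    abs_of_pos (inv_pos.mpr hl₀), Complex.real_smul, Complex.ofReal_inv]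

theorem norm_pow_sub_pow_le {x y : ℂ} {M : ℝ} (hx : ‖x‖ ≤ M) (hy : ‖y‖ ≤ M) (n : ℕ) :
    ‖x ^ n - y ^ n‖ ≤ n * M ^ (n - 1) * ‖x - y‖ := by
  have hderiv : ∀ z ∈ Metric.closedBall (0 : ℂ) M, ‖n * z ^ (n - 1)‖ ≤ n * M ^ (n - 1) := by
    intro z hz
    rw [norm_mul, norm_pow, Complex.norm_natCast]
    gcongr
    exact mem_closedBall_zero_iff.mp hz
  exact (convex_closedBall 0 M).norm_image_sub_le_of_norm_hasDerivWithin_le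
    (fun z _ => (hasDerivAt_pow n z).hasDerivWithinAt) hderiv
    (mem_closedBall_zero_iff.mpr hy) (mem_closedBall_zero_iff.mpr hx)

theorem norm_indicator_pow_sub_modelSymbol_pow_le (α c₃ : ℝ) (hc : 0 ≤ c) (hcc₄ : c ≤ c₄)
    (hC : 0 ≤ C) (hdecay : ∀ θ : ℝ, |θ| ≤ π → ‖fourierSymbol a θ‖ ≤ Real.exp (-c * θ ^ 4))
    (hmodel : ∀ θ : ℝ, |θ| ≤ π → ‖fourierSymbol a θ - modelSymbol α c₃ c₄ θ‖ ≤ C * |θ| ^ 5)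
    (hn : 2 ≤ n) (hl : l ^ 4 = n) (θ : ℝ) :
    ‖(Ioc (-π) π).indicator (fun θ : ℝ => fourierSymbol a θ ^ n) θ - modelSymbol α c₃ c₄ θ ^ n‖ ≤
      n * (C + 1) * (|θ| ^ 5 * Real.exp (-(c / 2) * (l * θ) ^ 4)) := by
  have hmodel_decay : ‖modelSymbol α c₃ c₄ θ‖ ≤ Real.exp (-c * θ ^ 4) := by
    rw [norm_modelSymbol]
    gcongr
  have hpow := exp_quartic_pow_pred_le hc hn hl θ
  by_cases hθ : θ ∈ Ioc (-π) π
  · have hθ' : |θ| ≤ π := abs_le.mpr ⟨hθ.1.le, hθ.2⟩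
    rw [indicator_of_mem hθ]
    calc ‖fourierSymbol a θ ^ n - modelSymbol α c₃ c₄ θ ^ n‖
        ≤ n * Real.exp (-c * θ ^ 4) ^ (n - 1) * ‖fourierSymbol a θ - modelSymbol α c₃ c₄ θ‖ :=
          norm_pow_sub_pow_le (hdecay θ hθ') hmodel_decay n
      _ ≤ n * Real.exp (-(c / 2) * (l * θ) ^ 4) * ((C + 1) * |θ| ^ 5) := by
          gcongr
          exact (hmodel θ hθ').trans (by gcongr; linarith)
      _ = n * (C + 1) * (|θ| ^ 5 * Real.exp (-(c / 2) * (l * θ) ^ 4)) := by ring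
  · have hθ' : 1 ≤ |θ| := by
      by_contra! hlt
      have hπ := Real.pi_gt_three
      exact hθ ⟨by linarith [neg_abs_le θ], by linarith [le_abs_self θ]⟩
    have hone : 1 ≤ n * (C + 1) * |θ| ^ 5 := by
      have : (1 : ℝ) ≤ n := mod_cast one_le_two.trans hn
      have : 1 ≤ C + 1 := by linarith
      have : 1 ≤ |θ| ^ 5 := one_le_pow₀ hθ'
      exact one_le_mul_of_one_le_of_one_le (one_le_mul_of_one_le_of_one_le ‹_› ‹_›) ‹_›
    rw [indicator_of_notMem hθ, zero_sub, norm_neg, norm_pow, ← mul_assoc]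
    calc ‖modelSymbol α c₃ c₄ θ‖ ^ n ≤ Real.exp (-c * θ ^ 4) ^ n := by gcongr
      _ ≤ Real.exp (-c * θ ^ 4) ^ (n - 1) := pow_le_pow_of_le_one (Real.exp_pos _).le
          (Real.exp_le_one_iff.mpr (by rw [neg_mul, neg_nonpos]; positivity)) n.pred_le
      _ ≤ Real.exp (-(c / 2) * (l * θ) ^ 4) := hpow
      _ ≤ n * (C + 1) * |θ| ^ 5 * Real.exp (-(c / 2) * (l * θ) ^ 4) :=
          le_mul_of_one_le_left (Real.exp_pos _).le hone

theorem indicator_pow_mul_exp_eq (a : ℤ →₀ ℂ) (n : ℕ) (j : ℤ) :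
    (fun θ : ℝ => (Ioc (-π) π).indicator (fun θ : ℝ => fourierSymbol a θ ^ n) θ *
      Complex.exp (-(Complex.I * j * θ))) =
    (Ioc (-π) π).indicator fun θ : ℝ =>
      fourierSymbol (convPow a n) θ * Complex.exp (-(Complex.I * j * θ)) := by
  simp only [fourierSymbol_convPow]
  exact funext fun θ => (indicator_mul_left _ _ fun θ : ℝ => Complex.exp _).symm

theorem integral_indicator_pow_mul_exp (a : ℤ →₀ ℂ) (n : ℕ) (j : ℤ) :
    ∫ θ : ℝ, (Ioc (-π) π).indicator (fun θ : ℝ => fourierSymbol a θ ^ n) θ *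
      Complex.exp (-(Complex.I * j * θ)) = 2 * π * convPow a n j := by
  rw [indicator_pow_mul_exp_eq, integral_indicator measurableSet_Ioc,
    ← intervalIntegral.integral_of_le (neg_le_self Real.pi_pos.le), integral_fourierSymbol_mul_exp]

theorem integrable_indicator_pow_mul_exp (a : ℤ →₀ ℂ) (n : ℕ) (j : ℤ) :
    Integrable fun θ : ℝ => (Ioc (-π) π).indicator (fun θ : ℝ => fourierSymbol a θ ^ n) θ *
      Complex.exp (-(Complex.I * j * θ)) := by
  have := continuous_fourierSymbol (convPow a n)
  rw [indicator_pow_mul_exp_eq, integrable_indicator_iff measurableSet_Ioc]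
  exact Continuous.integrableOn_Ioc (by fun_prop)

theorem norm_convPow_sub_oscInt_le (hc : 0 < c) (hcc₄ : c ≤ c₄)
    (hC : 0 ≤ C) (hdecay : ∀ θ : ℝ, |θ| ≤ π → ‖fourierSymbol a θ‖ ≤ Real.exp (-c * θ ^ 4))
    (hmodel : ∀ θ : ℝ, |θ| ≤ π → ‖fourierSymbol a θ - modelSymbol α c₃ c₄ θ‖ ≤ C * |θ| ^ 5)
    (hn : 2 ≤ n) (hl₀ : 0 < l) (hl : l ^ 4 = n) (j : ℤ) :
    ‖convPow a n j - (2 * π * l : ℝ)⁻¹ * oscInt c₃ c₄ l ((α * n - j) / l ^ 2)‖ ≤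
      (2 * π)⁻¹ * ((C + 1) * quarticMoment (c / 2) 5 / l ^ 2) := by
  have hπ : (π : ℂ) ≠ 0 := mod_cast Real.pi_ne_zero
  have hdiff : convPow a n j - ((2 * π * l : ℝ)⁻¹ : ℝ) * oscInt c₃ c₄ l ((α * n - j) / l ^ 2) =
      ((2 * π : ℝ)⁻¹ : ℝ) * ∫ θ : ℝ,
        ((Ioc (-π) π).indicator (fun θ : ℝ => fourierSymbol a θ ^ n) θ -
          modelSymbol α c₃ c₄ θ ^ n) * Complex.exp (-(Complex.I * j * θ)) := by
    simp only [sub_mul]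
    rw [integral_sub (integrable_indicator_pow_mul_exp a n j)
      (integrable_modelSymbol_pow_mul_exp α c₃ (hc.trans_le hcc₄) hl₀ hl j),
      integral_indicator_pow_mul_exp, integral_modelSymbol_pow_mul_exp α c₃ c₄ hl₀ hl]
    push_cast
    field_simp
  have hbound : ‖∫ θ : ℝ, ((Ioc (-π) π).indicator (fun θ : ℝ => fourierSymbol a θ ^ n) θ -
      modelSymbol α c₃ c₄ θ ^ n) * Complex.exp (-(Complex.I * j * θ))‖ ≤
      ∫ θ : ℝ, n * (C + 1) * (|θ| ^ 5 * Real.exp (-(c / 2) * (l * θ) ^ 4)) := by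
    refine norm_integral_le_of_norm_le
      ((integrable_abs_pow_mul_exp_quartic_scaled (half_pos hc) hl₀ 5).const_mul _)
      (ae_of_all _ fun θ => ?_)
    have hphase : ‖Complex.exp (-(Complex.I * j * θ))‖ = 1 := by
      simpa [mul_assoc] using norm_exp_neg_I_mul (j * θ)
    rw [norm_mul, hphase, mul_one]
    exact norm_indicator_pow_sub_modelSymbol_pow_le α c₃ hc.le hcc₄ hC hdecay hmodel hn hl θ
  rw [hdiff, norm_mul, Complex.norm_real, Real.norm_of_nonneg (by positivity)]
  gcongr
  refine hbound.trans_eq ?_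
  rw [integral_const_mul, integral_abs_pow_mul_exp_quartic_scaled _ hl₀, ← hl]
  field_simp
  ring

end

/-! ### A first-derivative test for oscillatory integrals -/

theorem norm_integral_mul_deriv_le {G G' : ℝ → ℂ} {g g' h h' : ℝ → ℝ} {a b : ℝ} (hab : a ≤ b)
    (hG : ∀ t ∈ Icc a b, HasDerivAt G (G' t) t) (hg : ∀ t ∈ Icc a b, HasDerivAt g (g' t) t)
    (hh : ∀ t ∈ Icc a b, HasDerivAt h (h' t) t)
    (hG'c : ContinuousOn G' (Icc a b)) (hg'c : ContinuousOn g' (Icc a b))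
    (hh'c : ContinuousOn h' (Icc a b))
    (hG_le : ∀ t ∈ Icc a b, ‖G t‖ ≤ 1) (hgh : ∀ t ∈ Icc a b, |g' t| ≤ h' t) :
    ‖∫ t in a..b, g t * G' t‖ ≤ |g a| + |g b| + (h b - h a) := by
  have hmul (x : ℝ) {t : ℝ} (ht : t ∈ Icc a b) : ‖(x : ℂ) * G t‖ ≤ |x| := by
    rw [norm_mul, Complex.norm_real, Real.norm_eq_abs]
    exact mul_le_of_le_one_right (abs_nonneg _) (hG_le t ht)
  have hboundary_a := hmul (g a) (left_mem_Icc.mpr hab)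
  have hboundary_b := hmul (g b) (right_mem_Icc.mpr hab)
  rw [← uIcc_of_le hab] at hG hg hh hG'c hg'c hh'c
  have hintegral : ‖∫ t in a..b, g' t * G t‖ ≤ h b - h a := by
    rw [← intervalIntegral.integral_eq_sub_of_hasDerivAt hh hh'c.intervalIntegrable]
    exact intervalIntegral.norm_integral_le_of_norm_le hab
      (ae_of_all _ fun t ht =>
        (hmul _ (Ioc_subset_Icc_self ht)).trans (hgh t (Ioc_subset_Icc_self ht)))
      hh'c.intervalIntegrable
  rw [intervalIntegral.integral_mul_deriv_eq_deriv_mul (fun t ht => (hg t ht).ofReal_comp) hG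
    (Complex.continuous_ofReal.comp_continuousOn hg'c).intervalIntegrable hG'c.intervalIntegrable]
  linarith [norm_sub_le (g b * G b - g a * G a) (∫ t in a..b, g' t * G t),
    norm_sub_le (g b * G b) (g a * G a)]

theorem abs_deriv_div_le {x x' p p' m : ℝ} (hm : 0 < m) (hmp : m ≤ |p|) (hx : x ∈ Icc 0 1)
    (hx' : x' ≤ 0) (hp' : 0 ≤ p') :
    |x' * p⁻¹ + x * (-p' / p ^ 2)| ≤ -(x' / m) - -p' / p ^ 2 := by
  have hinv : |p⁻¹| ≤ m⁻¹ := by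
    rw [abs_inv]
    exact inv_anti₀ hm hmp
  have hquot : 0 ≤ p' / p ^ 2 := by positivity
  rw [neg_div, sub_neg_eq_add]
  calc |x' * p⁻¹ + x * -(p' / p ^ 2)| ≤ |x' * p⁻¹| + |x * -(p' / p ^ 2)| := abs_add_le _ _
    _ = -x' * |p⁻¹| + x * (p' / p ^ 2) := by
        rw [abs_mul, abs_mul, abs_neg, abs_of_nonpos hx', abs_of_nonneg hx.1, abs_of_nonneg hquot]
    _ ≤ -x' * m⁻¹ + 1 * (p' / p ^ 2) := by
        gcongr
        · exact neg_nonneg.mpr hx'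
        · exact hx.2
    _ = -(x' / m) + p' / p ^ 2 := by ring

theorem boundary_terms_le {x y u v m : ℝ} (hm : 0 < m) (hx : x ∈ Icc 0 1) (hy : y ∈ Icc 0 1)
    (hu : |u| ≤ m⁻¹) (hv : |v| ≤ m⁻¹) :
    |x * u| + |y * v| + (-(y / m) - v - (-(x / m) - u)) ≤ 5 / m := by
  have hxu : |x * u| ≤ m⁻¹ := by
    rw [abs_mul, abs_of_nonneg hx.1]
    exact (mul_le_of_le_one_left (abs_nonneg _) hx.2).trans hu
  have hyv : |y * v| ≤ m⁻¹ := by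
    rw [abs_mul, abs_of_nonneg hy.1]
    exact (mul_le_of_le_one_left (abs_nonneg _) hy.2).trans hv
  have hxm : x / m ≤ m⁻¹ := by simpa using div_le_div_of_nonneg_right hx.2 hm.le
  have hym : 0 ≤ y / m := div_nonneg hy.1 hm.le
  rw [div_eq_mul_inv 5]
  linarith [(abs_le.mp hu).2, (abs_le.mp hv).1]

theorem norm_integral_mul_exp_neg_I_mul_le {f f' ψ p p' : ℝ → ℝ} {a b m : ℝ} (hab : a ≤ b)
    (hm : 0 < m) (hf : ∀ t ∈ Icc a b, HasDerivAt f (f' t) t) (hf'c : ContinuousOn f' (Icc a b))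
    (hf_mem : ∀ t ∈ Icc a b, f t ∈ Icc 0 1) (hf' : ∀ t ∈ Icc a b, f' t ≤ 0)
    (hψ : ∀ t ∈ Icc a b, HasDerivAt ψ (p t) t) (hp : ∀ t ∈ Icc a b, HasDerivAt p (p' t) t)
    (hp'c : ContinuousOn p' (Icc a b)) (hp' : ∀ t ∈ Icc a b, 0 ≤ p' t)
    (hmp : ∀ t ∈ Icc a b, m ≤ |p t|) :
    ‖∫ t in a..b, f t * Complex.exp (-(Complex.I * ψ t))‖ ≤ 5 / m := by
  have hp₀ : ∀ t ∈ Icc a b, p t ≠ 0 := fun t ht => abs_pos.mp (hm.trans_le (hmp t ht))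
  have hfc : ContinuousOn f (Icc a b) := HasDerivAt.continuousOn hf
  have hpc : ContinuousOn p (Icc a b) := HasDerivAt.continuousOn hp
  have hψc : ContinuousOn ψ (Icc a b) := HasDerivAt.continuousOn hψ
  have hinv_d : ∀ t ∈ Icc a b, HasDerivAt (fun t => (p t)⁻¹) (-p' t / p t ^ 2) t :=
    fun t ht => (hp t ht).fun_inv (hp₀ t ht)
  have : ContinuousOn (fun t => (p t)⁻¹) (Icc a b) := hpc.inv₀ hp₀
  have hinv'_c : ContinuousOn (fun t => -p' t / p t ^ 2) (Icc a b) :=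
    hp'c.neg.div (hpc.pow 2) fun t ht => pow_ne_zero 2 (hp₀ t ht)
  -- Integrate by parts with `f e^{-iψ} = i (f / p) (e^{-iψ})'`.
  have hparts := norm_integral_mul_deriv_le hab
    (fun t ht => ((hψ t ht).ofReal_comp.const_mul Complex.I).fun_neg.cexp)
    (fun t ht => (hf t ht).fun_mul (hinv_d t ht))
    (fun t ht => ((hf t ht).div_const m).fun_neg.fun_sub (hinv_d t ht))
    (by fun_prop) (by fun_prop) (by fun_prop) (fun t _ => (norm_exp_neg_I_mul (ψ t)).le)
    (fun t ht => abs_deriv_div_le hm (hmp t ht) (hf_mem t ht) (hf' t ht) (hp' t ht))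
  have hrewrite : ∫ t in a..b, ((f t * (p t)⁻¹ : ℝ) : ℂ) *
      (Complex.exp (-(Complex.I * ψ t)) * -(Complex.I * p t)) =
      -Complex.I * ∫ t in a..b, f t * Complex.exp (-(Complex.I * ψ t)) := by
    rw [← intervalIntegral.integral_const_mul]
    refine intervalIntegral.integral_congr fun t ht => ?_
    have : (p t : ℂ) ≠ 0 := mod_cast hp₀ t (uIcc_of_le hab ▸ ht)
    push_cast
    field_simp
  rw [hrewrite, norm_mul, norm_neg, Complex.norm_I, one_mul] at hparts
  have hinv_le {t : ℝ} (ht : t ∈ Icc a b) : |(p t)⁻¹| ≤ m⁻¹ := by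
    rw [abs_inv]
    exact inv_anti₀ hm (hmp t ht)
  have ha := left_mem_Icc.mpr hab
  have hb := right_mem_Icc.mpr hab
  exact hparts.trans
    (boundary_terms_le hm (hf_mem a ha) (hf_mem b hb) (hinv_le ha) (hinv_le hb))

/-! ### The oscillatory integral -/

theorem hasDerivAt_exp_quartic (c₄ t : ℝ) : HasDerivAt (fun t => Real.exp (-c₄ * t ^ 4))
    (Real.exp (-c₄ * t ^ 4) * (-c₄ * (4 * t ^ 3))) t := by
  simpa using ((hasDerivAt_pow 4 t).const_mul (-c₄)).exp

theorem hasDerivAt_cubicPhase (c₃ l z t : ℝ) :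
    HasDerivAt (cubicPhase c₃ l z) (l * (3 * c₃ * t ^ 2 - z)) t := by
  refine ((((hasDerivAt_pow 3 t).const_mul c₃).sub
    ((hasDerivAt_id t).const_mul z)).const_mul l).congr_deriv ?_
  push_cast
  ring

theorem norm_integral_oscKernel_le {c₃ c₄ l z m a b : ℝ} (hc₃ : 0 ≤ c₃) (hc₄ : 0 ≤ c₄)
    (hl : 0 < l) (hm : 0 < m) (ha : 0 ≤ a) (hab : a ≤ b)
    (hp : ∀ t ∈ Icc a b, m ≤ |3 * c₃ * t ^ 2 - z|) :
    ‖∫ t in a..b, oscKernel c₃ c₄ l z t‖ ≤ 5 / (l * m) := by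
  have hpos : ∀ t ∈ Icc a b, 0 ≤ t := fun t ht => ha.trans ht.1
  have hquad (t : ℝ) :
      HasDerivAt (fun t => l * (3 * c₃ * t ^ 2 - z)) (l * (3 * c₃ * (2 * t))) t := by
    simpa using (((hasDerivAt_pow 2 t).const_mul (3 * c₃)).sub_const z).const_mul l
  refine norm_integral_mul_exp_neg_I_mul_le hab (mul_pos hl hm)
    (fun t _ => hasDerivAt_exp_quartic c₄ t) (by fun_prop) (fun t _ => ⟨(Real.exp_pos _).le, ?_⟩)
    (fun t ht => ?_) (fun t _ => hasDerivAt_cubicPhase c₃ l z t) (fun t _ => hquad t)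
    (by fun_prop) (fun t ht => ?_) (fun t ht => ?_)
  · exact Real.exp_le_one_iff.mpr (by rw [neg_mul, neg_nonpos]; positivity)
  · have := hpos t ht
    exact mul_nonpos_of_nonneg_of_nonpos (Real.exp_pos _).le
      (mul_nonpos_of_nonpos_of_nonneg (by linarith) (by positivity))
  · have := hpos t ht
    positivity
  · rw [abs_mul, abs_of_pos hl]
    exact mul_le_mul_of_nonneg_left (hp t ht) hl.le

theorem norm_integral_Ioi_oscKernel_le {c₃ c₄ l z m a : ℝ} (hc₃ : 0 ≤ c₃) (hc₄ : 0 < c₄)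
    (hl : 0 < l) (hm : 0 < m) (ha : 0 ≤ a)
    (hp : ∀ t, a ≤ t → m ≤ |3 * c₃ * t ^ 2 - z|) :
    ‖∫ t in Ioi a, oscKernel c₃ c₄ l z t‖ ≤ 5 / (l * m) := by
  refine le_of_tendsto (intervalIntegral_tendsto_integral_Ioi a
    (integrable_oscKernel hc₄ c₃ l z).integrableOn tendsto_id).norm ?_
  filter_upwards [eventually_ge_atTop a] with b hb
  exact norm_integral_oscKernel_le hc₃ hc₄.le hl hm ha hb fun t ht => hp t ht.1

theorem oscInt_eq_two_mul_re {c₄ : ℝ} (hc₄ : 0 < c₄) (c₃ l z : ℝ) :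
    oscInt c₃ c₄ l z = ((2 * (∫ t in Ioi 0, oscKernel c₃ c₄ l z t).re : ℝ) : ℂ) := by
  have hint := integrable_oscKernel hc₄ c₃ l z
  have hconj (t : ℝ) : oscKernel c₃ c₄ l z (-t) = conj (oscKernel c₃ c₄ l z t) := by
    rw [oscKernel, oscKernel, map_mul, Complex.conj_ofReal, ← Complex.exp_conj,
      Even.neg_pow ⟨2, rfl⟩]
    congr 2
    simp [cubicPhase]
    ring
  have hneg : ∫ t in Iic 0, oscKernel c₃ c₄ l z t = conj (∫ t in Ioi 0, oscKernel c₃ c₄ l z t) := by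
    simp only [← integral_conj, ← hconj, integral_comp_neg_Ioi, neg_zero]
  rw [oscInt, ← intervalIntegral.integral_Iic_add_Ioi hint.integrableOn hint.integrableOn, hneg,
    add_comm, Complex.add_conj]

theorem norm_oscInt_le_of_neg {c₃ c₄ l z : ℝ} (hc₃ : 0 ≤ c₃) (hc₄ : 0 < c₄)
    (hl : 0 < l) (hz : z < 0) : ‖oscInt c₃ c₄ l z‖ ≤ 10 / (l * -z) := by
  have hhalf : ‖∫ t in Ioi 0, oscKernel c₃ c₄ l z t‖ ≤ 5 / (l * -z) := by
    refine norm_integral_Ioi_oscKernel_le hc₃ hc₄ hl (neg_pos.mpr hz) le_rfl fun t _ => ?_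
    have : 0 ≤ 3 * c₃ * t ^ 2 := by positivity
    exact (by linarith : -z ≤ 3 * c₃ * t ^ 2 - z).trans (le_abs_self _)
  rw [oscInt_eq_two_mul_re hc₄, Complex.norm_real, norm_mul, Real.norm_ofNat, Real.norm_eq_abs]
  calc 2 * |(∫ t in Ioi 0, oscKernel c₃ c₄ l z t).re| ≤ 2 * (5 / (l * -z)) := by
        gcongr
        exact (Complex.abs_re_le_norm _).trans hhalf
    _ = 10 / (l * -z) := by ring

/-! ### The Fresnel integral -/

theorem cexp_neg_add_I_mul_mul_sq (ε B r : ℝ) :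
    Complex.exp (-(ε + Complex.I * B) * (r : ℂ) ^ 2) =
      Real.exp (-ε * r ^ 2) * Complex.exp (-(Complex.I * (B * r ^ 2 : ℝ))) := by
  rw [Complex.ofReal_exp, ← Complex.exp_add]
  congr 1
  push_cast
  ring

theorem norm_integral_cexp_neg_mul_sq_le {ε B d b : ℝ} (hε : 0 ≤ ε) (hB : 0 < B) (hd : 0 < d)
    (hdb : d ≤ b) :
    ‖∫ r in d..b, Complex.exp (-(ε + Complex.I * B) * (r : ℂ) ^ 2)‖ ≤ 5 / (2 * B * d) := by
  have hgauss (r : ℝ) : HasDerivAt (fun r => Real.exp (-ε * r ^ 2))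
      (Real.exp (-ε * r ^ 2) * (-ε * (2 * r))) r := by
    simpa using ((hasDerivAt_pow 2 r).const_mul (-ε)).exp
  have hsq (r : ℝ) : HasDerivAt (fun r => B * r ^ 2) (2 * B * r) r :=
    ((hasDerivAt_pow 2 r).const_mul B).congr_deriv (by push_cast; ring)
  have hlin (r : ℝ) : HasDerivAt (fun r => 2 * B * r) (2 * B) r := by
    simpa using (hasDerivAt_id r).const_mul (2 * B)
  simp only [cexp_neg_add_I_mul_mul_sq]
  refine norm_integral_mul_exp_neg_I_mul_le hdb (by positivity) (fun r _ => hgauss r)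
    (by fun_prop) (fun r _ => ⟨(Real.exp_pos _).le, ?_⟩) (fun r hr => ?_) (fun r _ => hsq r)
    (fun r _ => hlin r) (by fun_prop) (fun r _ => by positivity) (fun r hr => ?_)
  · exact Real.exp_le_one_iff.mpr (by rw [neg_mul, neg_nonpos]; positivity)
  · have := hd.trans_le hr.1
    exact mul_nonpos_of_nonneg_of_nonpos (Real.exp_pos _).le
      (mul_nonpos_of_nonpos_of_nonneg (by linarith) (by positivity))
  · refine le_trans ?_ (le_abs_self _)
    gcongr
    exact hr.1

theorem norm_integral_cexp_neg_mul_sq_sub_le {ε B d : ℝ} (hε : 0 < ε) (hB : 0 < B) (hd : 0 < d) :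
    ‖(∫ r in 0..d, Complex.exp (-(ε + Complex.I * B) * (r : ℂ) ^ 2)) -
      (π / (ε + Complex.I * B)) ^ (1 / 2 : ℂ) / 2‖ ≤ 5 / (2 * B * d) := by
  have hre : 0 < (ε + Complex.I * B).re := by simpa using hε
  have hlim := intervalIntegral_tendsto_integral_Ioi (0 : ℝ)
    (integrable_cexp_neg_mul_sq hre).integrableOn tendsto_id
  rw [integral_gaussian_complex_Ioi hre] at hlim
  refine le_of_tendsto (hlim.const_sub _).norm ?_
  filter_upwards [eventually_ge_atTop d] with b hb
  have hcont : Continuous fun r : ℝ => Complex.exp (-(ε + Complex.I * B) * (r : ℂ) ^ 2) := by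
    fun_prop
  rw [id, ← intervalIntegral.integral_add_adjacent_intervals (hcont.intervalIntegrable 0 d)
    (hcont.intervalIntegrable d b), sub_add_cancel_left, norm_neg]
  exact norm_integral_cexp_neg_mul_sq_le hε.le hB hd hb

theorem pi_div_I_mul (B : ℝ) : (π / (Complex.I * B) : ℂ) = (π / B : ℝ) * -Complex.I := by
  rw [mul_comm Complex.I, ← div_div, Complex.div_I, Complex.ofReal_div, mul_neg]

theorem cpow_half_pi_div_I_mul {B : ℝ} (hB : 0 < B) :
    (π / (Complex.I * B) : ℂ) ^ (1 / 2 : ℂ) =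
      √(π / B) * Complex.exp (-(Complex.I * (π / 4 : ℝ))) := by
  have hquot : 0 < π / B := div_pos Real.pi_pos hB
  have hquot' : ((π / B : ℝ) : ℂ) ≠ 0 := mod_cast hquot.ne'
  rw [pi_div_I_mul, Complex.cpow_def_of_ne_zero (mul_ne_zero hquot' (by simp)),
    Complex.log_ofReal_mul hquot (by simp), Complex.log_neg_I, Real.sqrt_eq_rpow,
    Real.rpow_def_of_pos hquot, Complex.ofReal_exp, ← Complex.exp_add]
  congr 1
  push_cast
  ring

theorem norm_fresnel_sub_le {B d : ℝ} (hB : 0 < B) (hd : 0 < d) :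
    ‖(∫ r in 0..d, Complex.exp (-(Complex.I * (B * r ^ 2 : ℝ)))) -
      √(π / B) * Complex.exp (-(Complex.I * (π / 4 : ℝ))) / 2‖ ≤ 5 / (2 * B * d) := by
  have hB' : (B : ℂ) ≠ 0 := mod_cast hB.ne'
  have hslit : (π / ((0 : ℝ) + Complex.I * B) : ℂ) ∈ Complex.slitPlane := by
    rw [Complex.ofReal_zero, zero_add, pi_div_I_mul, Complex.mem_slitPlane_iff]
    simp [Real.pi_ne_zero, hB.ne']
  have hintegral : Continuous fun ε : ℝ =>
      ∫ r in 0..d, Complex.exp (-(ε + Complex.I * B) * (r : ℂ) ^ 2) := by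
    apply intervalIntegral.continuous_parametric_intervalIntegral_of_continuous'
    fun_prop
  have hvalue : ContinuousAt (fun ε : ℝ => (π / (ε + Complex.I * B)) ^ (1 / 2 : ℂ)) 0 :=
    (continuousAt_const.div (by fun_prop) (by simp [hB'])).cpow continuousAt_const hslit
  have hlim := (hintegral.continuousAt.fun_sub (hvalue.div_const 2)).norm.tendsto.mono_left
    (nhdsWithin_le_nhds (s := Ioi (0 : ℝ)))
  simp only [cexp_neg_add_I_mul_mul_sq 0, neg_zero, zero_mul, Real.exp_zero, Complex.ofReal_one,
    one_mul] at hlim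
  rw [Complex.ofReal_zero, zero_add, cpow_half_pi_div_I_mul hB] at hlim
  refine le_of_tendsto hlim ?_
  filter_upwards [self_mem_nhdsWithin] with ε hε
  exact norm_integral_cexp_neg_mul_sq_sub_le hε hB hd

/-! ### Stationary phase -/

theorem abs_exp_quartic_sub_le {c₄ s t R : ℝ} (hc₄ : 0 ≤ c₄) (hs : |s| ≤ R) (ht : |t| ≤ R) :
    |Real.exp (-c₄ * t ^ 4) - Real.exp (-c₄ * s ^ 4)| ≤ 4 * c₄ * R ^ 3 * |t - s| := by
  refine (convex_Icc (-R) R).norm_image_sub_le_of_norm_hasDerivWithin_le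
    (fun x _ => (hasDerivAt_exp_quartic c₄ x).hasDerivWithinAt) (fun x hx => ?_)
    (abs_le.mp hs) (abs_le.mp ht)
  have hexp : Real.exp (-c₄ * x ^ 4) ≤ 1 :=
    Real.exp_le_one_iff.mpr (by rw [neg_mul, neg_nonpos]; positivity)
  rw [norm_mul, norm_mul, norm_mul, norm_neg, norm_pow, Real.norm_ofNat, Real.norm_of_nonneg hc₄,
    Real.norm_of_nonneg (Real.exp_pos _).le, Real.norm_eq_abs]
  calc Real.exp (-c₄ * x ^ 4) * (c₄ * (4 * |x| ^ 3)) ≤ 1 * (c₄ * (4 * R ^ 3)) := by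
        gcongr
        exact abs_le.mpr hx
    _ = 4 * c₄ * R ^ 3 := by ring

theorem norm_exp_neg_I_mul_sub_le (x y : ℝ) :
    ‖Complex.exp (-(Complex.I * x)) - Complex.exp (-(Complex.I * y))‖ ≤ |x - y| := by
  have hfactor : Complex.exp (-(Complex.I * x)) - Complex.exp (-(Complex.I * y)) =
      Complex.exp (-(Complex.I * y)) * (Complex.exp (Complex.I * (y - x : ℝ)) - 1) := by
    rw [mul_sub, ← Complex.exp_add, mul_one]
    congr 2
    push_cast
    ring
  rw [hfactor, norm_mul, norm_exp_neg_I_mul, one_mul, abs_sub_comm]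
  exact Real.norm_exp_I_mul_ofReal_sub_one_le

theorem cubicPhase_add (c₃ l s r : ℝ) :
    cubicPhase c₃ l (3 * c₃ * s ^ 2) (s + r) =
      cubicPhase c₃ l (3 * c₃ * s ^ 2) s + 3 * l * c₃ * s * r ^ 2 + l * c₃ * r ^ 3 := by
  simp only [cubicPhase]
  ring

theorem norm_oscKernel_add_sub_le {c₃ c₄ l s d r : ℝ} (hc₃ : 0 ≤ c₃) (hc₄ : 0 ≤ c₄) (hl : 0 ≤ l)
    (hs : 0 ≤ s) (hr : |r| ≤ d) :
    ‖oscKernel c₃ c₄ l (3 * c₃ * s ^ 2) (s + r) - oscKernel c₃ c₄ l (3 * c₃ * s ^ 2) s *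
      Complex.exp (-(Complex.I * (3 * l * c₃ * s * r ^ 2 : ℝ)))‖ ≤
      l * c₃ * d ^ 3 + 4 * c₄ * (s + d) ^ 3 * d := by
  have hd : 0 ≤ d := (abs_nonneg r).trans hr
  set φ := cubicPhase c₃ l (3 * c₃ * s ^ 2) s with hφ
  have hdecomp : oscKernel c₃ c₄ l (3 * c₃ * s ^ 2) (s + r) - oscKernel c₃ c₄ l (3 * c₃ * s ^ 2) s *
      Complex.exp (-(Complex.I * (3 * l * c₃ * s * r ^ 2 : ℝ))) =
      (Real.exp (-c₄ * (s + r) ^ 4) : ℂ) *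
        (Complex.exp (-(Complex.I * (φ + 3 * l * c₃ * s * r ^ 2 + l * c₃ * r ^ 3 : ℝ))) -
          Complex.exp (-(Complex.I * (φ + 3 * l * c₃ * s * r ^ 2 : ℝ)))) +
      ((Real.exp (-c₄ * (s + r) ^ 4) - Real.exp (-c₄ * s ^ 4) : ℝ) : ℂ) *
        Complex.exp (-(Complex.I * (φ + 3 * l * c₃ * s * r ^ 2 : ℝ))) := by
    rw [oscKernel, oscKernel, cubicPhase_add, ← hφ, Complex.ofReal_add φ, mul_add, neg_add,
      Complex.exp_add, Complex.ofReal_sub]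
    ring
  have hexp : Real.exp (-c₄ * (s + r) ^ 4) ≤ 1 :=
    Real.exp_le_one_iff.mpr (by rw [neg_mul, neg_nonpos]; positivity)
  have hphase := norm_exp_neg_I_mul_sub_le (φ + 3 * l * c₃ * s * r ^ 2 + l * c₃ * r ^ 3)
    (φ + 3 * l * c₃ * s * r ^ 2)
  have hquartic := abs_exp_quartic_sub_le (R := s + d) hc₄ (by rw [abs_of_nonneg hs]; linarith)
    ((abs_add_le s r).trans (by rw [abs_of_nonneg hs]; gcongr))
  rw [add_sub_cancel_left, abs_mul, abs_mul, abs_of_nonneg hl, abs_of_nonneg hc₃, abs_pow] at hphase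
  rw [add_sub_cancel_left] at hquartic
  rw [hdecomp]
  refine (norm_add_le _ _).trans (add_le_add ?_ ?_)
  · rw [norm_mul, Complex.norm_real, Real.norm_of_nonneg (Real.exp_pos _).le]
    exact (mul_le_of_le_one_left (norm_nonneg _) hexp).trans (hphase.trans (by gcongr))
  · rw [norm_mul, norm_exp_neg_I_mul, mul_one, Complex.norm_real]
    exact hquartic.trans (by gcongr)

theorem norm_integral_oscKernel_sub_fresnel_le {c₃ c₄ l s d : ℝ} (hc₃ : 0 ≤ c₃) (hc₄ : 0 ≤ c₄)
    (hl : 0 ≤ l) (hs : 0 ≤ s) (hd : 0 ≤ d) :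
    ‖(∫ t in (s - d)..(s + d), oscKernel c₃ c₄ l (3 * c₃ * s ^ 2) t) -
      oscKernel c₃ c₄ l (3 * c₃ * s ^ 2) s *
        ∫ r in (-d)..d, Complex.exp (-(Complex.I * (3 * l * c₃ * s * r ^ 2 : ℝ)))‖ ≤
      2 * d * (l * c₃ * d ^ 3 + 4 * c₄ * (s + d) ^ 3 * d) := by
  have hcont := continuous_oscKernel c₃ c₄ l (3 * c₃ * s ^ 2)
  rw [sub_eq_add_neg s, ← intervalIntegral.integral_comp_add_left (oscKernel c₃ c₄ l _) s,
    ← intervalIntegral.integral_const_mul, ← intervalIntegral.integral_sub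
      (Continuous.intervalIntegrable (by fun_prop) _ _)
      (Continuous.intervalIntegrable (by fun_prop) _ _)]
  have hbound := intervalIntegral.norm_integral_le_of_norm_le_const (a := -d) (b := d)
    (f := fun r => oscKernel c₃ c₄ l (3 * c₃ * s ^ 2) (s + r) -
      oscKernel c₃ c₄ l (3 * c₃ * s ^ 2) s *
        Complex.exp (-(Complex.I * (3 * l * c₃ * s * r ^ 2 : ℝ)))) fun r hr => by
      rw [uIoc_of_le (by linarith)] at hr
      exact norm_oscKernel_add_sub_le hc₃ hc₄ hl hs (abs_le.mpr ⟨hr.1.le, hr.2⟩)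
  rwa [sub_neg_eq_add, ← two_mul, abs_of_nonneg (by positivity), mul_comm _ (2 * d)] at hbound

theorem norm_fresnel_symm_sub_le {B d : ℝ} (hB : 0 < B) (hd : 0 < d) :
    ‖(∫ r in (-d)..d, Complex.exp (-(Complex.I * (B * r ^ 2 : ℝ)))) -
      √(π / B) * Complex.exp (-(Complex.I * (π / 4 : ℝ)))‖ ≤ 5 / (B * d) := by
  set F : ℝ → ℂ := fun r => Complex.exp (-(Complex.I * (B * r ^ 2 : ℝ))) with hF
  have hcont : Continuous F := by fun_prop
  have heven : ∫ r in (-d)..0, F r = ∫ r in 0..d, F r := by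
    rw [← neg_zero, ← intervalIntegral.integral_comp_neg, neg_zero]
    simp only [hF, neg_sq]
  rw [← intervalIntegral.integral_add_adjacent_intervals (hcont.intervalIntegrable (-d) 0)
    (hcont.intervalIntegrable 0 d), heven]
  set G : ℂ := √(π / B) * Complex.exp (-(Complex.I * (π / 4 : ℝ)))
  calc ‖(∫ r in 0..d, F r) + (∫ r in 0..d, F r) - G‖ = 2 * ‖(∫ r in 0..d, F r) - G / 2‖ := by
        rw [← Complex.norm_ofNat 2, ← norm_mul]
        ring_nf
    _ ≤ 2 * (5 / (2 * B * d)) := by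
        gcongr
        exact norm_fresnel_sub_le hB hd
    _ = 5 / (B * d) := by
        field_simp

theorem le_abs_quadratic_sub {c₃ s d t : ℝ} (hc₃ : 0 ≤ c₃) (hs : 0 ≤ s) (ht : 0 ≤ t)
    (hst : d ≤ |t - s|) : 3 * c₃ * (d * s) ≤ |3 * c₃ * t ^ 2 - 3 * c₃ * s ^ 2| := by
  rw [← mul_sub, sq_sub_sq, mul_comm (t + s), abs_mul, abs_mul (t - s),
    abs_of_nonneg (by positivity : 0 ≤ 3 * c₃),
    abs_of_nonneg (add_nonneg ht hs)]
  gcongr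
  exact le_add_of_nonneg_left ht

theorem norm_integral_Ioi_sub_le {E : Type*} [NormedAddCommGroup E] [NormedSpace ℝ E] {f : ℝ → E}
    (hf : Integrable f) (a b c : ℝ) (A B : E) :
    ‖(∫ t in Ioi a, f t) - B‖ ≤
      ‖∫ t in a..b, f t‖ + ‖∫ t in Ioi c, f t‖ + ‖(∫ t in b..c, f t) - A‖ + ‖A - B‖ := by
  rw [← intervalIntegral.integral_interval_add_Ioi (b := b) hf.integrableOn hf.integrableOn,
    ← intervalIntegral.integral_interval_add_Ioi (b := c) hf.integrableOn hf.integrableOn]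
  refine le_of_eq_of_le ?_ norm_add₄_le
  congr 1
  abel

theorem norm_integral_Ioi_oscKernel_sub_le {c₃ c₄ l s d : ℝ} (hc₃ : 0 < c₃) (hc₄ : 0 < c₄)
    (hl : 0 < l) (hd : 0 < d) (hds : d ≤ s) :
    ‖(∫ t in Ioi 0, oscKernel c₃ c₄ l (3 * c₃ * s ^ 2) t) -
      oscKernel c₃ c₄ l (3 * c₃ * s ^ 2) s *
        (√(π / (3 * l * c₃ * s)) * Complex.exp (-(Complex.I * (π / 4 : ℝ))))‖ ≤
      5 / (l * (c₃ * s * d)) + 2 * d * (l * c₃ * d ^ 3 + 4 * c₄ * (s + d) ^ 3 * d) := by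
  have hs : 0 < s := hd.trans_le hds
  have hint := integrable_oscKernel hc₄ c₃ l (3 * c₃ * s ^ 2)
  set F := ∫ r in (-d)..d, Complex.exp (-(Complex.I * (3 * l * c₃ * s * r ^ 2 : ℝ)))
  set G : ℂ := √(π / (3 * l * c₃ * s)) * Complex.exp (-(Complex.I * (π / 4 : ℝ)))
  have hm : 0 < 3 * c₃ * (d * s) := by positivity
  have hleft : ‖∫ t in 0..(s - d), oscKernel c₃ c₄ l (3 * c₃ * s ^ 2) t‖ ≤
      5 / (l * (3 * c₃ * (d * s))) :=
    norm_integral_oscKernel_le hc₃.le hc₄.le hl hm le_rfl (sub_nonneg.mpr hds) fun t ht =>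
      le_abs_quadratic_sub hc₃.le hs.le ht.1 (le_abs.mpr (Or.inr (by linarith [ht.2])))
  have hright : ‖∫ t in Ioi (s + d), oscKernel c₃ c₄ l (3 * c₃ * s ^ 2) t‖ ≤
      5 / (l * (3 * c₃ * (d * s))) :=
    norm_integral_Ioi_oscKernel_le hc₃.le hc₄ hl hm (by positivity) fun t ht =>
      le_abs_quadratic_sub hc₃.le hs.le (by linarith) (le_abs.mpr (Or.inl (by linarith)))
  have hmiddle := norm_integral_oscKernel_sub_fresnel_le hc₃.le hc₄.le hl.le hs.le hd.le
  have hfresnel := norm_fresnel_symm_sub_le (B := 3 * l * c₃ * s) (by positivity) hd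
  have hvalue : ‖oscKernel c₃ c₄ l (3 * c₃ * s ^ 2) s‖ ≤ 1 := by
    rw [norm_oscKernel]
    exact Real.exp_le_one_iff.mpr (by rw [neg_mul, neg_nonpos]; positivity)
  have hfresnel' : ‖oscKernel c₃ c₄ l (3 * c₃ * s ^ 2) s * F -
      oscKernel c₃ c₄ l (3 * c₃ * s ^ 2) s * G‖ ≤ 5 / (3 * l * c₃ * s * d) := by
    rw [← mul_sub, norm_mul]
    exact (mul_le_of_le_one_left (norm_nonneg _) hvalue).trans hfresnel
  have hthirds : 5 / (l * (c₃ * s * d)) = 5 / (l * (3 * c₃ * (d * s))) +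
      5 / (l * (3 * c₃ * (d * s))) + 5 / (3 * l * c₃ * s * d) := by
    field_simp
    norm_num
  have hsplit := norm_integral_Ioi_sub_le hint 0 (s - d) (s + d)
    (oscKernel c₃ c₄ l (3 * c₃ * s ^ 2) s * F) (oscKernel c₃ c₄ l (3 * c₃ * s ^ 2) s * G)
  linarith

theorem re_oscKernel_mul_fresnel (c₃ c₄ l s x : ℝ) :
    (oscKernel c₃ c₄ l (3 * c₃ * s ^ 2) s *
      (x * Complex.exp (-(Complex.I * (π / 4 : ℝ))))).re =
      Real.exp (-c₄ * s ^ 4) * x * Real.cos (l * (2 * c₃ * s ^ 3) - π / 4) := by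
  have hpolar : oscKernel c₃ c₄ l (3 * c₃ * s ^ 2) s *
      (x * Complex.exp (-(Complex.I * (π / 4 : ℝ)))) =
      ((Real.exp (-c₄ * s ^ 4) * x : ℝ) : ℂ) *
        Complex.exp ((l * (2 * c₃ * s ^ 3) - π / 4 : ℝ) * Complex.I) := by
    rw [oscKernel, mul_mul_mul_comm, ← Complex.exp_add, Complex.ofReal_mul]
    congr 2
    simp only [cubicPhase]
    push_cast
    ring
  rw [hpolar, Complex.re_ofReal_mul, Complex.exp_ofReal_mul_I_re]

theorem abs_norm_oscInt_sub_le {c₃ c₄ l s d : ℝ} (hc₃ : 0 < c₃) (hc₄ : 0 < c₄)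
    (hl : 0 < l) (hd : 0 < d) (hds : d ≤ s) :
    |‖oscInt c₃ c₄ l (3 * c₃ * s ^ 2)‖ - 2 * (Real.exp (-c₄ * s ^ 4) * √(π / (3 * l * c₃ * s)) *
      |Real.cos (l * (2 * c₃ * s ^ 3) - π / 4)|)| ≤
      2 * (5 / (l * (c₃ * s * d)) + 2 * d * (l * c₃ * d ^ 3 + 4 * c₄ * (s + d) ^ 3 * d)) := by
  have hre := (Complex.abs_re_le_norm _).trans
    (norm_integral_Ioi_oscKernel_sub_le hc₃ hc₄ hl hd hds)
  rw [Complex.sub_re, re_oscKernel_mul_fresnel] at hre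
  have hamp : 0 ≤ Real.exp (-c₄ * s ^ 4) * √(π / (3 * l * c₃ * s)) := by positivity
  rw [oscInt_eq_two_mul_re hc₄, Complex.norm_real, norm_mul, Real.norm_ofNat, Real.norm_eq_abs,
    ← mul_sub, abs_mul, abs_two]
  refine mul_le_mul_of_nonneg_left (le_trans ?_ hre) two_pos.le
  rw [← abs_of_nonneg hamp, ← abs_mul, abs_of_nonneg hamp]
  exact abs_abs_sub_abs_le_abs_sub _ _

/-- The positive stationary point of the phase `c₃ t³ - z t`. -/
def statPoint (c₃ z : ℝ) : ℝ := √(z / (3 * c₃))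

/-- The amplitude, at the rescaled position `z`, of the oscillating profile of the Green's
function. -/
def profileAmp (c₃ c₄ z : ℝ) : ℝ :=
  2 * Real.exp (-c₄ * statPoint c₃ z ^ 4) * √(π / (3 * c₃ * statPoint c₃ z))

/-- The phase of the oscillating profile of the Green's function: minus the value of
`c₃ t³ - z t` at its stationary point. -/
def profilePhase (c₃ z : ℝ) : ℝ := 2 * c₃ * statPoint c₃ z ^ 3

/-- The modulus of the leading-order profile of the rescaled Green's function at time `l⁴`. -/
def oscProfile (c₃ c₄ l z : ℝ) : ℝ :=
  profileAmp c₃ c₄ z * |Real.cos (l * profilePhase c₃ z - π / 4)|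

theorem statPoint_pos {c₃ z : ℝ} (hc₃ : 0 < c₃) (hz : 0 < z) : 0 < statPoint c₃ z :=
  Real.sqrt_pos.mpr (by positivity)

theorem statPoint_mono {c₃ : ℝ} (hc₃ : 0 ≤ c₃) : Monotone (statPoint c₃) :=
  fun _ _ h => Real.sqrt_le_sqrt (by gcongr)

theorem three_mul_statPoint_sq {c₃ z : ℝ} (hc₃ : 0 < c₃) (hz : 0 ≤ z) :
    3 * c₃ * statPoint c₃ z ^ 2 = z := by
  rw [statPoint, Real.sq_sqrt (by positivity)]
  field_simp

theorem abs_sqrt_mul_norm_oscInt_sub_le {c₃ c₄ l z d : ℝ} (hc₃ : 0 < c₃) (hc₄ : 0 < c₄)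
    (hl : 0 < l) (hz : 0 < z) (hd : 0 < d) (hdz : d ≤ statPoint c₃ z) :
    |√l * ‖oscInt c₃ c₄ l z‖ - oscProfile c₃ c₄ l z| ≤
      √l * (2 * (5 / (l * (c₃ * statPoint c₃ z * d)) +
        2 * d * (l * c₃ * d ^ 3 + 4 * c₄ * (statPoint c₃ z + d) ^ 3 * d))) := by
  have hbound := abs_norm_oscInt_sub_le hc₃ hc₄ hl hd hdz
  rw [three_mul_statPoint_sq hc₃ hz.le] at hbound
  refine le_trans (le_of_eq ?_) (mul_le_mul_of_nonneg_left hbound (Real.sqrt_nonneg l))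
  have hsqrt : √l * √(π / (3 * l * c₃ * statPoint c₃ z)) = √(π / (3 * c₃ * statPoint c₃ z)) := by
    rw [← Real.sqrt_mul hl.le]
    congr 1
    field_simp
  rw [← abs_of_nonneg (Real.sqrt_nonneg l), ← abs_mul, abs_of_nonneg (Real.sqrt_nonneg l), mul_sub,
    oscProfile, profileAmp, profilePhase, ← hsqrt]
  congr 1
  ring

-- The window `d = l ^ (-2/5)` balances the outer error `1 / (l d)` against the inner one `l d⁴`.
theorem sqrt_mul_window_errors {l d : ℝ} (hl : 1 ≤ l) (hd : d = l ^ (-(2 / 5) : ℝ)) :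
    √l * (l * d)⁻¹ = l ^ (-(1 / 10) : ℝ) ∧ √l * (l * d ^ 4) = l ^ (-(1 / 10) : ℝ) ∧
      √l * d ^ 2 ≤ l ^ (-(1 / 10) : ℝ) := by
  have hl₀ : 0 < l := one_pos.trans_le hl
  rw [Real.sqrt_eq_rpow, hd, ← Real.rpow_mul_natCast hl₀.le, ← Real.rpow_mul_natCast hl₀.le]
  refine ⟨?_, ?_, ?_⟩
  · rw [← div_eq_mul_inv, div_eq_iff (by positivity), ← Real.rpow_one_add' hl₀.le (by norm_num),
      ← Real.rpow_add hl₀]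
    norm_num
  · rw [← Real.rpow_one_add' hl₀.le (by norm_num), ← Real.rpow_add hl₀]
    norm_num
  · rw [← Real.rpow_add hl₀]
    exact Real.rpow_le_rpow_of_exponent_le hl (by norm_num)

theorem exists_abs_sqrt_mul_norm_oscInt_sub_le {c₃ c₄ e : ℝ} (hc₃ : 0 < c₃) (hc₄ : 0 < c₄)
    (he : 0 < e) (M : ℝ) : ∃ D : ℝ, ∀ᶠ l : ℝ in atTop, ∀ z ∈ Icc e M,
      |√l * ‖oscInt c₃ c₄ l z‖ - oscProfile c₃ c₄ l z| ≤ D * l ^ (-(1 / 10) : ℝ) := by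
  set s₀ := statPoint c₃ e
  set s₁ := statPoint c₃ M
  have hs₀ : 0 < s₀ := statPoint_pos hc₃ he
  have hs₁ : 0 ≤ s₁ := Real.sqrt_nonneg _
  refine ⟨2 * (5 / (c₃ * s₀) + 2 * (c₃ + 4 * c₄ * (s₁ + 1) ^ 3)), ?_⟩
  have hlim : Tendsto (fun l : ℝ => l ^ (-(2 / 5) : ℝ)) atTop (𝓝 0) :=
    tendsto_rpow_neg_atTop (by norm_num)
  filter_upwards [eventually_ge_atTop 1, hlim.eventually_lt_const hs₀] with l hl₁ hds₀ z hz
  have hl : 0 < l := one_pos.trans_le hl₁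
  obtain ⟨houter, hcubic, hquartic⟩ := sqrt_mul_window_errors hl₁ rfl
  set d := l ^ (-(2 / 5) : ℝ)
  set w := l ^ (-(1 / 10) : ℝ)
  have hd₀ : 0 < d := Real.rpow_pos_of_pos hl _
  have : 0 < w := Real.rpow_pos_of_pos hl _
  have hd₁ : d ≤ 1 := Real.rpow_le_one_of_one_le_of_nonpos hl₁ (by norm_num)
  have hs₀z : s₀ ≤ statPoint c₃ z := statPoint_mono hc₃.le hz.1
  have hzs₁ : statPoint c₃ z ≤ s₁ := statPoint_mono hc₃.le hz.2
  refine (abs_sqrt_mul_norm_oscInt_sub_le hc₃ hc₄ hl (he.trans_le hz.1) hd₀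
    (hds₀.le.trans hs₀z)).trans ?_
  calc √l * (2 * (5 / (l * (c₃ * statPoint c₃ z * d)) +
        2 * d * (l * c₃ * d ^ 3 + 4 * c₄ * (statPoint c₃ z + d) ^ 3 * d)))
      = 2 * (5 / (c₃ * statPoint c₃ z) * (√l * (l * d)⁻¹) + 2 * (c₃ * (√l * (l * d ^ 4)) +
          4 * c₄ * (statPoint c₃ z + d) ^ 3 * (√l * d ^ 2))) := by
        field_simp
    _ ≤ 2 * (5 / (c₃ * s₀) * w + 2 * (c₃ * w + 4 * c₄ * (s₁ + 1) ^ 3 * w)) := by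
        rw [houter, hcubic]
        have := hs₀.trans_le hs₀z
        gcongr
    _ = 2 * (5 / (c₃ * s₀) + 2 * (c₃ + 4 * c₄ * (s₁ + 1) ^ 3)) * w := by ring

/-! ### Riemann sums -/

theorem abs_mul_sub_integral_le_of_lipschitzOnWith {h : ℝ → ℝ} {K : ℝ≥0} {a b : ℝ} (hab : a ≤ b)
    (hh : LipschitzOnWith K h (Icc a b)) :
    |(b - a) * h b - ∫ u in a..b, h u| ≤ K * (b - a) ^ 2 := by
  have hint : IntervalIntegrable h volume a b :=
    hh.continuousOn.intervalIntegrable_of_Icc hab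
  rw [← smul_eq_mul, ← intervalIntegral.integral_const,
    ← intervalIntegral.integral_sub intervalIntegrable_const hint, ← Real.norm_eq_abs]
  calc ‖∫ u in a..b, (h b - h u)‖ ≤ K * (b - a) * |b - a| := by
        refine intervalIntegral.norm_integral_le_of_norm_le_const fun u hu => ?_
        rw [uIoc_of_le hab] at hu
        calc ‖h b - h u‖ ≤ K * ‖b - u‖ :=
              hh.norm_sub_le (right_mem_Icc.mpr hab) (Ioc_subset_Icc_self hu)
          _ ≤ K * (b - a) := by
              rw [Real.norm_of_nonneg (sub_nonneg.mpr hu.2)]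
              gcongr
              exact hu.1.le
    _ = K * (b - a) ^ 2 := by rw [abs_of_nonneg (sub_nonneg.mpr hab)]; ring

theorem abs_sum_Ico_div_sub_integral_le {h : ℝ → ℝ} {K : ℝ≥0} {x r : ℝ} (hr : 0 < r) {p q : ℤ}
    (hpq : p ≤ q) (hh : LipschitzOnWith K h (Icc ((x - q) / r) ((x - p) / r))) :
    |(∑ j ∈ Finset.Ico p q, h ((x - j) / r)) / r - ∫ u in (x - q) / r..(x - p) / r, h u| ≤
      K * (q - p) / r ^ 2 := by
  induction q, hpq using Int.leInduction with
  | base => simp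
  | succ q hpq ih =>
    have hpq' : (x - q) / r ≤ (x - p) / r := by
      gcongr
    have hstep : (x - (q + 1 : ℤ)) / r ≤ (x - q) / r := by
      push_cast
      gcongr
      linarith
    have hwidth : (x - q) / r - (x - (q + 1 : ℤ)) / r = 1 / r := by
      push_cast
      ring
    have hcell := abs_mul_sub_integral_le_of_lipschitzOnWith hstep
      (hh.mono (Icc_subset_Icc_right hpq'))
    have hprev := ih (hh.mono (Icc_subset_Icc_left hstep))
    rw [hwidth] at hcell
    rw [← Finset.insert_Ico_right_eq_Ico_add_one hpq, Finset.sum_insert (by simp),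
      ← intervalIntegral.integral_add_adjacent_intervals
        ((hh.continuousOn.mono (Icc_subset_Icc_right hpq')).intervalIntegrable_of_Icc hstep)
        ((hh.continuousOn.mono (Icc_subset_Icc_left hstep)).intervalIntegrable_of_Icc hpq')]
    calc _ = |(1 / r * h ((x - q) / r) - ∫ u in (x - (q + 1 : ℤ)) / r..(x - q) / r, h u) +
          ((∑ j ∈ Finset.Ico p q, h ((x - j) / r)) / r -
            ∫ u in (x - q) / r..(x - p) / r, h u)| := by
          congr 1
          ring
      _ ≤ K * (1 / r) ^ 2 + K * (q - p) / r ^ 2 :=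
          (abs_add_le _ _).trans (add_le_add hcell hprev)
      _ = K * ((q + 1 : ℤ) - p) / r ^ 2 := by push_cast; ring

/-- The integers `j` for which the rescaled displacement `(x - j) / r` lies in `[e, M]`, for
`r > 0`. -/
def scaledWindow (x r e M : ℝ) : Finset ℤ := Finset.Icc ⌈x - M * r⌉ ⌊x - e * r⌋

theorem mem_scaledWindow {x r e M : ℝ} (hr : 0 < r) {j : ℤ} :
    j ∈ scaledWindow x r e M ↔ (x - j) / r ∈ Icc e M := by
  rw [scaledWindow, Finset.mem_Icc, Int.ceil_le, Int.le_floor, mem_Icc, le_div_iff₀ hr,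
    div_le_iff₀ hr, and_comm, sub_le_comm, le_sub_comm]

theorem card_scaledWindow_le {x r e M : ℝ} (hr : 0 ≤ r) (heM : e ≤ M) :
    ((scaledWindow x r e M).card : ℝ) ≤ (M - e) * r + 1 := by
  have hwidth : 0 ≤ (M - e) * r := mul_nonneg (sub_nonneg.mpr heM) hr
  have hfloor := Int.floor_le (x - e * r)
  have hceil := Int.le_ceil (x - M * r)
  have hcard : ((scaledWindow x r e M).card : ℝ) =
      max (⌊x - e * r⌋ + 1 - ⌈x - M * r⌉ : ℝ) 0 := by
    rw [scaledWindow, Int.card_Icc]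
    exact_mod_cast Int.toNat_eq_max _
  rw [hcard]
  exact max_le (by linarith) (by linarith)

theorem abs_intervalIntegral_le_div_of_sub_mul_le_one {h : ℝ → ℝ} {u v r B : ℝ} (hr : 0 < r)
    (huv : u ≤ v) (hshort : (v - u) * r ≤ 1) (hB : ∀ t ∈ Icc u v, |h t| ≤ B) :
    |∫ t in u..v, h t| ≤ B / r := by
  have hB₀ : 0 ≤ B := (abs_nonneg _).trans (hB u (left_mem_Icc.mpr huv))
  calc ‖∫ t in u..v, h t‖ ≤ B * |v - u| :=
        intervalIntegral.norm_integral_le_of_norm_le_const fun t ht =>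
          hB t (Ioc_subset_Icc_self (uIoc_of_le huv ▸ ht))
    _ ≤ B * (1 / r) := by
        rw [abs_of_nonneg (sub_nonneg.mpr huv)]
        gcongr
        rwa [le_div_iff₀ hr]
    _ = B / r := mul_one_div _ _

theorem abs_integral_sub_integral_le_of_mul_le_one {h : ℝ → ℝ} {r B e b c M : ℝ} (hr : 0 < r)
    (hh : ContinuousOn h (Icc e M)) (hB : ∀ u ∈ Icc e M, |h u| ≤ B) (heb : e ≤ b) (hbc : b ≤ c)
    (hcM : c ≤ M) (hbottom : (b - e) * r ≤ 1) (htop : (M - c) * r ≤ 1) :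
    |(∫ u in e..M, h u) - ∫ u in b..c, h u| ≤ B / r + B / r := by
  have hint {u v : ℝ} (huv : u ≤ v) (heu : e ≤ u) (hvM : v ≤ M) : IntervalIntegrable h volume u v :=
    (hh.mono (Icc_subset_Icc heu hvM)).intervalIntegrable_of_Icc huv
  have hbM : b ≤ M := hbc.trans hcM
  have hec : e ≤ c := heb.trans hbc
  have hdiff : (∫ u in e..M, h u) - ∫ u in b..c, h u =
      (∫ u in e..b, h u) + ∫ u in c..M, h u := by
    rw [← intervalIntegral.integral_add_adjacent_intervals (hint heb le_rfl hbM)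
        (hint hbM heb le_rfl),
      ← intervalIntegral.integral_add_adjacent_intervals (hint hbc heb hcM) (hint hcM hec le_rfl)]
    ring
  rw [hdiff]
  exact (abs_add_le _ _).trans (add_le_add
    (abs_intervalIntegral_le_div_of_sub_mul_le_one hr heb hbottom
      fun t ht => hB t ⟨ht.1, ht.2.trans hbM⟩)
    (abs_intervalIntegral_le_div_of_sub_mul_le_one hr hcM htop
      fun t ht => hB t ⟨hec.trans ht.1, ht.2⟩))

theorem abs_sum_scaledWindow_div_sub_integral_le {h : ℝ → ℝ} {K : ℝ≥0} {x r e M B : ℝ}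
    (hr : 0 < r) (hMe : 1 ≤ (M - e) * r) (hh : LipschitzOnWith K h (Icc e M))
    (hB : ∀ u ∈ Icc e M, |h u| ≤ B) :
    |(∑ j ∈ scaledWindow x r e M, h ((x - j) / r)) / r - ∫ u in e..M, h u| ≤
      (K * (M - e) + 3 * B) / r := by
  set p := ⌈x - M * r⌉ with hp
  set q := ⌊x - e * r⌋ with hq
  obtain ⟨hp₁, hp₂⟩ : (p : ℝ) - 1 < x - M * r ∧ x - M * r ≤ p := Int.ceil_eq_iff.mp hp.symm
  obtain ⟨hq₁, hq₂⟩ : (q : ℝ) ≤ x - e * r ∧ x - e * r < q + 1 := Int.floor_eq_iff.mp hq.symm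
  have hpq : p ≤ q := Int.lt_add_one_iff.mp (by
    have : (p : ℝ) < q + 1 := by linarith
    exact_mod_cast this)
  set bot := (x - q) / r
  set top := (x - p) / r
  have hbotr : bot * r = x - q := div_mul_cancel₀ _ hr.ne'
  have htopr : top * r = x - p := div_mul_cancel₀ _ hr.ne'
  have le_of_mul_r {u v : ℝ} : u * r ≤ v * r → u ≤ v := (mul_le_mul_iff_left₀ hr).mp
  have hpq' : (p : ℝ) ≤ q := mod_cast hpq
  have hebot : e ≤ bot := le_of_mul_r (by linarith)
  have hbottop : bot ≤ top := le_of_mul_r (by linarith)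
  have htopM : top ≤ M := le_of_mul_r (by linarith)
  have hcells : |(∑ j ∈ Finset.Ico p q, h ((x - j) / r)) / r - ∫ u in bot..top, h u| ≤
      K * (M - e) / r := by
    refine (abs_sum_Ico_div_sub_integral_le hr hpq
      (hh.mono (Icc_subset_Icc hebot htopM))).trans ?_
    rw [div_le_div_iff₀ (by positivity) hr]
    calc K * ((q : ℝ) - p) * r ≤ K * ((M - e) * r) * r := by gcongr; linarith
      _ = K * (M - e) * r ^ 2 := by ring
  have hlast : |h bot / r| ≤ B / r := by
    rw [abs_div, abs_of_pos hr]
    gcongr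
    exact hB _ ⟨hebot, hbottop.trans htopM⟩
  have hends := abs_integral_sub_integral_le_of_mul_le_one hr hh.continuousOn hB hebot hbottop htopM
    (by linarith) (by linarith)
  rw [scaledWindow, ← hp, ← hq, ← Finset.Ico_insert_right hpq, Finset.sum_insert (by simp),
    add_div]
  rw [abs_le] at hlast hends hcells ⊢
  have hsum : (K * (M - e) + 3 * B) / r = K * (M - e) / r + 3 * (B / r) := by ring
  rw [hsum]
  constructor <;> linarith

/-! ### Averaging of a rapidly oscillating factor -/

theorem integral_abs_cos : ∫ t in (0 : ℝ)..π, |Real.cos t| = 2 := by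
  have hperiodic : Function.Periodic (fun t => |Real.cos t|) π := fun t => by
    simp only [Real.cos_add_pi, abs_neg]
  calc ∫ t in (0 : ℝ)..π, |Real.cos t| = ∫ t in -(π / 2)..π / 2, |Real.cos t| := by
        have hshift := hperiodic.intervalIntegral_add_eq 0 (-(π / 2))
        rwa [zero_add, neg_add_eq_sub, sub_half] at hshift
    _ = ∫ t in -(π / 2)..π / 2, Real.cos t := by
        refine intervalIntegral.integral_congr fun t ht => ?_
        rw [uIcc_of_le (by linarith [Real.pi_pos])] at ht
        exact abs_of_nonneg (Real.cos_nonneg_of_mem_Icc ht)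
    _ = 2 := by
        rw [integral_cos, Real.sin_neg, Real.sin_pi_div_two]
        norm_num

theorem exists_bounded_antideriv_of_periodic {g : ℝ → ℝ} {T : ℝ} (hg : Continuous g)
    (hperiodic : Function.Periodic g T) (hT : T ≠ 0) (hmean : ∫ t in 0..T, g t = 0) :
    ∃ (Φ : ℝ → ℝ) (K : ℝ), (∀ t, HasDerivAt Φ (g t) t) ∧ ∀ t, |Φ t| ≤ K := by
  set Φ : ℝ → ℝ := fun x => ∫ t in 0..x, g t
  have hderiv : ∀ t, HasDerivAt Φ (g t) t := fun t =>
    (hg.integral_hasStrictDerivAt 0 t).hasDerivAt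
  have hΦperiodic : Function.Periodic Φ T := fun t => by
    have hadd := hperiodic.intervalIntegral_add_eq_add 0 t fun _ _ => hg.intervalIntegrable _ _
    rwa [zero_add, hmean, add_zero] at hadd
  obtain ⟨K, hK⟩ := (hΦperiodic.isBounded_of_continuous hT
    (continuous_iff_continuousAt.mpr fun t => (hderiv t).continuousAt)).exists_norm_le
  exact ⟨Φ, K, hderiv, fun t => hK _ (mem_range_self t)⟩

theorem abs_integral_mul_deriv_le {Q Q' V V' : ℝ → ℝ} {e M D K : ℝ} (heM : e ≤ M)
    (hQ : ∀ t ∈ Icc e M, HasDerivAt Q (Q' t) t) (hQ' : ContinuousOn Q' (Icc e M))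
    (hV : ∀ t ∈ Icc e M, HasDerivAt V (V' t) t) (hV' : ContinuousOn V' (Icc e M))
    (hD : ∀ t ∈ Icc e M, |Q' t| ≤ D) (hK : ∀ t ∈ Icc e M, |V t| ≤ K) :
    |∫ t in e..M, Q t * V' t| ≤ (|Q M| + |Q e| + D * (M - e)) * K := by
  have hleft := left_mem_Icc.mpr heM
  have hright := right_mem_Icc.mpr heM
  have hint : |∫ t in e..M, Q' t * V t| ≤ D * K * (M - e) := by
    rw [← abs_of_nonneg (sub_nonneg.mpr heM), ← Real.norm_eq_abs]
    refine intervalIntegral.norm_integral_le_of_norm_le_const fun t ht => ?_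
    have ht' : t ∈ Icc e M := Ioc_subset_Icc_self (uIoc_of_le heM ▸ ht)
    rw [norm_mul]
    exact mul_le_mul (hD t ht') (hK t ht') (abs_nonneg _) ((abs_nonneg _).trans (hD t ht'))
  rw [intervalIntegral.integral_mul_deriv_eq_deriv_mul (by rwa [uIcc_of_le heM])
    (by rwa [uIcc_of_le heM]) (hQ'.intervalIntegrable_of_Icc heM)
    (hV'.intervalIntegrable_of_Icc heM)]
  calc |Q M * V M - Q e * V e - ∫ t in e..M, Q' t * V t|
      ≤ |Q M| * |V M| + |Q e| * |V e| + |∫ t in e..M, Q' t * V t| := by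
        rw [← abs_mul, ← abs_mul]
        exact (abs_sub _ _).trans (add_le_add_left (abs_sub _ _) _)
    _ ≤ |Q M| * K + |Q e| * K + D * K * (M - e) := by
        gcongr
        exacts [hK M hright, hK e hleft]
    _ = (|Q M| + |Q e| + D * (M - e)) * K := by ring

theorem exists_abs_integral_mul_abs_cos_sub_le {Q Q' ψ ψ' : ℝ → ℝ} {e M : ℝ} (heM : e ≤ M)
    (hQ : ∀ t ∈ Icc e M, HasDerivAt Q (Q' t) t) (hQ' : ContinuousOn Q' (Icc e M))
    (hψ : ∀ t ∈ Icc e M, HasDerivAt ψ (ψ' t) t) (hψ' : ContinuousOn ψ' (Icc e M)) (φ : ℝ) :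
    ∃ D, ∀ l : ℝ, 0 < l →
      |(∫ t in e..M, Q t * ψ' t * |Real.cos (l * ψ t - φ)|) -
        2 / π * ∫ t in e..M, Q t * ψ' t| ≤ D / l := by
  have hmean : ∫ t in 0..π, (|Real.cos t| - 2 / π) = 0 := by
    rw [intervalIntegral.integral_sub (Continuous.intervalIntegrable (by fun_prop) _ _)
      intervalIntegrable_const, integral_abs_cos, intervalIntegral.integral_const, sub_zero,
      smul_eq_mul, mul_div_cancel₀ _ Real.pi_ne_zero, sub_self]
  obtain ⟨Φ, K, hΦ, hK⟩ := exists_bounded_antideriv_of_periodic (by fun_prop)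
    (fun t => by simp only [Real.cos_add_pi, abs_neg]) Real.pi_ne_zero hmean
  obtain ⟨D, hD⟩ := isCompact_Icc.exists_bound_of_continuousOn hQ'
  refine ⟨(|Q M| + |Q e| + D * (M - e)) * K, fun l hl => ?_⟩
  have hQc : ContinuousOn Q (Icc e M) := HasDerivAt.continuousOn hQ
  have hψc : ContinuousOn ψ (Icc e M) := HasDerivAt.continuousOn hψ
  have hderiv : ∀ t ∈ Icc e M, HasDerivAt (fun t => Φ (l * ψ t - φ) / l)
      ((|Real.cos (l * ψ t - φ)| - 2 / π) * (l * ψ' t) / l) t := fun t ht =>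
    (HasDerivAt.comp t (hΦ _) (((hψ t ht).const_mul l).sub_const φ)).div_const l
  have hbound : ∀ t ∈ Icc e M, |Φ (l * ψ t - φ) / l| ≤ K / l := fun t _ => by
    rw [abs_div, abs_of_pos hl]
    gcongr
    exact hK _
  calc _ = |∫ t in e..M, Q t * ((|Real.cos (l * ψ t - φ)| - 2 / π) * (l * ψ' t) / l)| := by
        rw [← intervalIntegral.integral_const_mul, ← intervalIntegral.integral_sub
          (ContinuousOn.intervalIntegrable_of_Icc heM (by fun_prop))
          (ContinuousOn.intervalIntegrable_of_Icc heM (by fun_prop))]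
        congr 2 with t
        field_simp
    _ ≤ (|Q M| + |Q e| + D * (M - e)) * (K / l) :=
        abs_integral_mul_deriv_le heM hQ hQ' hderiv (by fun_prop) hD hbound
    _ = (|Q M| + |Q e| + D * (M - e)) * K / l := (mul_div_assoc _ _ _).symm

/-! ### The asymptotic profile -/

theorem contDiffOn_statPoint {c₃ : ℝ} (hc₃ : 0 < c₃) : ContDiffOn ℝ 1 (statPoint c₃) (Ioi 0) :=
  ContDiffOn.sqrt (by fun_prop) fun _ hz => (div_pos hz (by positivity)).ne'

theorem hasDerivAt_profilePhase {c₃ z : ℝ} (hc₃ : 0 < c₃) (hz : 0 < z) :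
    HasDerivAt (profilePhase c₃) (statPoint c₃ z) z := by
  have hs : statPoint c₃ z ≠ 0 := (statPoint_pos hc₃ hz).ne'
  have hsqrt : HasDerivAt (statPoint c₃) (1 / (3 * c₃) / (2 * statPoint c₃ z)) z :=
    ((hasDerivAt_id z).div_const (3 * c₃)).sqrt (div_pos hz (by positivity)).ne'
  convert! (hsqrt.fun_pow 3).const_mul (2 * c₃) using 1
  push_cast
  field_simp

theorem contDiffOn_profilePhase {c₃ : ℝ} (hc₃ : 0 < c₃) :
    ContDiffOn ℝ 1 (profilePhase c₃) (Ioi 0) :=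
  contDiffOn_const.mul ((contDiffOn_statPoint hc₃).pow 3)

theorem contDiffOn_profileAmp {c₃ : ℝ} (hc₃ : 0 < c₃) (c₄ : ℝ) :
    ContDiffOn ℝ 1 (profileAmp c₃ c₄) (Ioi 0) := by
  have hs := contDiffOn_statPoint hc₃
  have hpos : ∀ z ∈ Ioi (0 : ℝ), 3 * c₃ * statPoint c₃ z ≠ 0 := fun z hz =>
    (mul_pos (by positivity) (statPoint_pos hc₃ hz)).ne'
  exact (contDiffOn_const.mul (contDiffOn_const.mul (hs.pow 4)).exp).mul
    (.sqrt (contDiffOn_const.div (contDiffOn_const.mul hs) hpos) fun z hz =>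
      div_ne_zero Real.pi_ne_zero (hpos z hz))

section

variable {c₃ e M : ℝ} (hc₃ : 0 < c₃) (c₄ : ℝ) (he : 0 < e)

include hc₃ he

theorem exists_abs_integral_oscProfile_sub_le (heM : e ≤ M) :
    ∃ D, ∀ l : ℝ, 0 < l →
      |(∫ z in e..M, oscProfile c₃ c₄ l z) - 2 / π * ∫ z in e..M, profileAmp c₃ c₄ z| ≤ D / l := by
  have hsub : Icc e M ⊆ Ioi 0 := fun t ht => he.trans_le ht.1
  have hpos : ∀ z ∈ Ioi (0 : ℝ), statPoint c₃ z ≠ 0 := fun z hz => (statPoint_pos hc₃ hz).ne'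
  have hquot : ContDiffOn ℝ 1 (fun z => profileAmp c₃ c₄ z / statPoint c₃ z) (Ioi 0) :=
    (contDiffOn_profileAmp hc₃ c₄).div (contDiffOn_statPoint hc₃) hpos
  obtain ⟨D, hD⟩ := exists_abs_integral_mul_abs_cos_sub_le heM
    (fun t ht => ((hquot.differentiableOn one_ne_zero).differentiableAt
      (isOpen_Ioi.mem_nhds (hsub ht))).hasDerivAt)
    ((hquot.continuousOn_deriv_of_isOpen isOpen_Ioi le_rfl).mono hsub)
    (fun t ht => hasDerivAt_profilePhase hc₃ (hsub ht))
    ((contDiffOn_statPoint hc₃).continuousOn.mono hsub) (π / 4)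
  have hcancel : ∀ z ∈ uIcc e M,
      profileAmp c₃ c₄ z / statPoint c₃ z * statPoint c₃ z = profileAmp c₃ c₄ z := fun z hz =>
    div_mul_cancel₀ _ (hpos z (hsub (uIcc_of_le heM ▸ hz)))
  refine ⟨D, fun l hl => ?_⟩
  have hbound := hD l hl
  rwa [intervalIntegral.integral_congr hcancel,
    intervalIntegral.integral_congr (g := oscProfile c₃ c₄ l) fun z hz => by
      rw [hcancel z hz, oscProfile]] at hbound

theorem exists_abs_profileAmp_le (M : ℝ) : ∃ B, ∀ z ∈ Icc e M, |profileAmp c₃ c₄ z| ≤ B :=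
  isCompact_Icc.exists_bound_of_continuousOn
    ((contDiffOn_profileAmp hc₃ c₄).continuousOn.mono fun _ ht => he.trans_le ht.1)

end

theorem abs_oscProfile_le (c₃ c₄ l z : ℝ) : |oscProfile c₃ c₄ l z| ≤ |profileAmp c₃ c₄ z| := by
  rw [oscProfile, abs_mul, abs_abs]
  exact mul_le_of_le_one_right (abs_nonneg _) (Real.abs_cos_le_one _)

theorem abs_oscProfile_sub_le {c₃ c₄ l u v : ℝ} (hl : 0 ≤ l) :
    |oscProfile c₃ c₄ l u - oscProfile c₃ c₄ l v| ≤ |profileAmp c₃ c₄ u - profileAmp c₃ c₄ v| +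
      |profileAmp c₃ c₄ v| * (l * |profilePhase c₃ u - profilePhase c₃ v|) := by
  set cosAt : ℝ → ℝ := fun z => |Real.cos (l * profilePhase c₃ z - π / 4)|
  have hcos : |cosAt u - cosAt v| ≤ l * |profilePhase c₃ u - profilePhase c₃ v| := by
    calc |cosAt u - cosAt v|
        ≤ |l * profilePhase c₃ u - π / 4 - (l * profilePhase c₃ v - π / 4)| :=
          (abs_abs_sub_abs_le_abs_sub _ _).trans (Real.abs_cos_sub_cos_le _ _)
      _ = l * |profilePhase c₃ u - profilePhase c₃ v| := by
          rw [sub_sub_sub_cancel_right, ← mul_sub, abs_mul, abs_of_nonneg hl]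
  have hcos_le : |cosAt u| ≤ 1 := (abs_abs _).trans_le (Real.abs_cos_le_one _)
  calc |profileAmp c₃ c₄ u * cosAt u - profileAmp c₃ c₄ v * cosAt v|
      = |(profileAmp c₃ c₄ u - profileAmp c₃ c₄ v) * cosAt u +
          profileAmp c₃ c₄ v * (cosAt u - cosAt v)| := by
        congr 1
        ring
    _ ≤ |profileAmp c₃ c₄ u - profileAmp c₃ c₄ v| * |cosAt u| +
          |profileAmp c₃ c₄ v| * |cosAt u - cosAt v| := by
        rw [← abs_mul, ← abs_mul]
        exact abs_add_le _ _
    _ ≤ _ := by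
        gcongr
        exact mul_le_of_le_one_right (abs_nonneg _) hcos_le

theorem exists_lipschitzOnWith_oscProfile {c₃ e : ℝ} (hc₃ : 0 < c₃) (c₄ : ℝ) (he : 0 < e) (M : ℝ) :
    ∃ K : ℝ≥0, ∀ l : ℝ≥0, 1 ≤ l → LipschitzOnWith (K * l) (oscProfile c₃ c₄ l) (Icc e M) := by
  have hsub : Icc e M ⊆ Ioi 0 := fun t ht => he.trans_le ht.1
  obtain ⟨K₁, hK₁⟩ := ((contDiffOn_profileAmp hc₃ c₄).mono hsub).exists_lipschitzOnWith
    one_ne_zero (convex_Icc e M) isCompact_Icc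
  obtain ⟨K₂, hK₂⟩ := ((contDiffOn_profilePhase hc₃).mono hsub).exists_lipschitzOnWith
    one_ne_zero (convex_Icc e M) isCompact_Icc
  obtain ⟨B, hB⟩ := exists_abs_profileAmp_le hc₃ c₄ he M
  refine ⟨K₁ + B.toNNReal * K₂, fun l hl => .of_dist_le_mul fun u hu v hv => ?_⟩
  have hamp : |profileAmp c₃ c₄ u - profileAmp c₃ c₄ v| ≤ K₁ * |u - v| := hK₁.dist_le_mul u hu v hv
  have hphase : |profilePhase c₃ u - profilePhase c₃ v| ≤ K₂ * |u - v| :=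
    hK₂.dist_le_mul u hu v hv
  have hampB : |profileAmp c₃ c₄ v| ≤ B.toNNReal := (hB v hv).trans (Real.le_coe_toNNReal B)
  calc |oscProfile c₃ c₄ l u - oscProfile c₃ c₄ l v|
      ≤ |profileAmp c₃ c₄ u - profileAmp c₃ c₄ v| +
          |profileAmp c₃ c₄ v| * (l * |profilePhase c₃ u - profilePhase c₃ v|) :=
        abs_oscProfile_sub_le l.2
    _ ≤ K₁ * |u - v| * l + B.toNNReal * (l * (K₂ * |u - v|)) :=
        add_le_add (hamp.trans (le_mul_of_one_le_right (by positivity) hl)) (by gcongr)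
    _ = ((K₁ + B.toNNReal * K₂) * l : ℝ≥0) * |u - v| := by
        push_cast
        ring

theorem exists_abs_sum_oscProfile_sub_le {c₃ e M : ℝ} (hc₃ : 0 < c₃) (c₄ : ℝ) (he : 0 < e)
    (heM : e < M) :
    ∃ D, ∀ᶠ l : ℝ in atTop, ∀ x : ℝ,
      |(∑ j ∈ scaledWindow x (l ^ 2) e M, oscProfile c₃ c₄ l ((x - j) / l ^ 2)) / l ^ 2 -
        2 / π * ∫ z in e..M, profileAmp c₃ c₄ z| ≤ D / l := by
  obtain ⟨D, hD⟩ := exists_abs_integral_oscProfile_sub_le hc₃ c₄ he heM.le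
  obtain ⟨K, hK⟩ := exists_lipschitzOnWith_oscProfile hc₃ c₄ he M
  obtain ⟨B, hB⟩ := exists_abs_profileAmp_le hc₃ c₄ he M
  have hMe : 0 < M - e := sub_pos.mpr heM
  have hB₀ : 0 ≤ B := (abs_nonneg _).trans (hB e (left_mem_Icc.mpr heM.le))
  refine ⟨K * (M - e) + 3 * B + D, ?_⟩
  filter_upwards [eventually_ge_atTop 1,
    ((tendsto_pow_atTop two_ne_zero).const_mul_atTop hMe).eventually_ge_atTop 1] with l hl hl' x
  have hl₀ : 0 < l := by linarith
  lift l to ℝ≥0 using hl₀.le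
  have hsum := abs_sum_scaledWindow_div_sub_integral_le (x := x) (by positivity) hl' (hK l hl)
    fun u hu => (abs_oscProfile_le c₃ c₄ l u).trans (hB u hu)
  calc _ ≤ (↑(K * l) * (M - e) + 3 * B) / l ^ 2 + D / l :=
        (abs_sub_le _ _ _).trans (add_le_add hsum (hD l hl₀))
    _ ≤ (K * l * (M - e) + 3 * B * l) / l ^ 2 + D / l := by
        have : 3 * B ≤ 3 * B * l := le_mul_of_one_le_right (by positivity) hl
        rw [NNReal.coe_mul]
        gcongr
    _ = (K * (M - e) + 3 * B + D) / l := by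
        field_simp

theorem profileAmp_eq {c₃ z : ℝ} (hc₃ : 0 < c₃) (c₄ : ℝ) (hz : 0 < z) :
    profileAmp c₃ c₄ z = 2 * √(π / (3 * c₃)) * (3 * c₃) ^ (1 / 4 : ℝ) *
      (z ^ (-(1 / 4) : ℝ) * Real.exp (-(c₄ / (3 * c₃) ^ 2) * z ^ (2 : ℝ))) := by
  have hpos : 0 < 3 * c₃ := by positivity
  have hpow : statPoint c₃ z ^ 4 = z ^ 2 / (3 * c₃) ^ 2 := by
    rw [show statPoint c₃ z ^ 4 = (statPoint c₃ z ^ 2) ^ 2 by ring, statPoint,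
      Real.sq_sqrt (by positivity), div_pow]
  have hsqrt : √(π / (3 * c₃ * statPoint c₃ z)) =
      √(π / (3 * c₃)) * ((3 * c₃) ^ (1 / 4 : ℝ) * z ^ (-(1 / 4) : ℝ)) := by
    rw [← div_div, Real.sqrt_div (by positivity), div_eq_mul_inv]
    congr 1
    rw [statPoint, Real.sqrt_eq_rpow, Real.sqrt_eq_rpow, ← Real.rpow_mul (by positivity),
      Real.div_rpow hz.le hpos.le, inv_div, div_eq_mul_inv, Real.rpow_neg hz.le]
    norm_num
  rw [profileAmp, hpow, hsqrt, Real.rpow_two]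
  ring_nf

theorem integrableOn_profileAmp {c₃ c₄ : ℝ} (hc₃ : 0 < c₃) (hc₄ : 0 < c₄) :
    IntegrableOn (profileAmp c₃ c₄) (Ioi 0) := by
  have hint := (integrableOn_rpow_mul_exp_neg_mul_rpow (p := 2) (s := -(1 / 4))
    (b := c₄ / (3 * c₃) ^ 2) (by norm_num) (by norm_num) (by positivity)).const_mul
    (2 * √(π / (3 * c₃)) * (3 * c₃) ^ (1 / 4 : ℝ))
  exact IntegrableOn.congr_fun hint (fun z hz => (profileAmp_eq hc₃ c₄ hz).symm) measurableSet_Ioi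

theorem integral_profileAmp {c₃ c₄ : ℝ} (hc₃ : 0 < c₃) (hc₄ : 0 < c₄) :
    ∫ z in Ioi 0, profileAmp c₃ c₄ z = √π * Real.Gamma (3 / 8) * √(3 * c₃) / c₄ ^ (3 / 8 : ℝ) := by
  have hpos : 0 < 3 * c₃ := by positivity
  have hquarters : (3 * c₃) ^ (1 / 4 : ℝ) * (3 * c₃) ^ (3 / 4 : ℝ) = √(3 * c₃) * √(3 * c₃) := by
    rw [← Real.rpow_add hpos, Real.mul_self_sqrt hpos.le]
    norm_num
  have hscale :
      (c₄ / (3 * c₃) ^ 2) ^ (-(3 / 8) : ℝ) = (3 * c₃) ^ (3 / 4 : ℝ) / c₄ ^ (3 / 8 : ℝ) := by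
    rw [Real.rpow_neg (by positivity), Real.div_rpow hc₄.le (by positivity), inv_div,
      ← Real.rpow_natCast_mul hpos.le]
    norm_num
  calc ∫ z in Ioi 0, profileAmp c₃ c₄ z
      = 2 * √(π / (3 * c₃)) * (3 * c₃) ^ (1 / 4 : ℝ) *
          ((c₄ / (3 * c₃) ^ 2) ^ (-(3 / 8) : ℝ) * (1 / 2) * Real.Gamma (3 / 8)) := by
        rw [setIntegral_congr_fun measurableSet_Ioi fun z hz => profileAmp_eq hc₃ c₄ hz,
          integral_const_mul, integral_rpow_mul_exp_neg_mul_rpow (by norm_num) (by norm_num)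
          (by positivity)]
        norm_num
    _ = √π / √(3 * c₃) * ((3 * c₃) ^ (1 / 4 : ℝ) * (3 * c₃) ^ (3 / 4 : ℝ)) * Real.Gamma (3 / 8) /
          c₄ ^ (3 / 8 : ℝ) := by
        rw [hscale, Real.sqrt_div Real.pi_nonneg]
        ring
    _ = _ := by
        rw [hquarters]
        field_simp

theorem two_div_pi_mul_integral_profileAmp {c₃ c₄ : ℝ} (hc₃ : 0 < c₃) (hc₄ : 0 < c₄) :
    (2 * π)⁻¹ * (2 / π * ∫ z in Ioi 0, profileAmp c₃ c₄ z) =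
      8 * Real.Gamma (11 / 8) / (√3 * π ^ (3 / 2 : ℝ)) *
        (c₃ ^ (1 / 2 : ℝ) / c₄ ^ (3 / 8 : ℝ)) := by
  have hGamma : Real.Gamma (11 / 8) = 3 / 8 * Real.Gamma (3 / 8) := by
    rw [← Real.Gamma_add_one (by norm_num)]
    norm_num
  have hpi : π ^ (3 / 2 : ℝ) = π * √π := by
    rw [Real.sqrt_eq_rpow, ← Real.rpow_one_add' Real.pi_nonneg (by norm_num)]
    norm_num
  rw [integral_profileAmp hc₃ hc₄, hGamma, hpi, Real.sqrt_mul zero_le_three, ← Real.sqrt_eq_rpow]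
  field_simp
  rw [Real.sq_sqrt Real.pi_nonneg, Real.sq_sqrt zero_le_three]

theorem tendsto_integral_profileAmp {c₃ c₄ : ℝ} (hc₃ : 0 < c₃) (hc₄ : 0 < c₄) :
    Tendsto (fun M : ℝ => ∫ z in M⁻¹..M, profileAmp c₃ c₄ z) atTop
      (𝓝 (∫ z in Ioi 0, profileAmp c₃ c₄ z)) := by
  have hcover : AECover (volume.restrict (Ioi (0 : ℝ))) atTop fun M : ℝ => Ioc M⁻¹ M := by
    refine ⟨?_, fun _ => measurableSet_Ioc⟩
    filter_upwards [ae_restrict_mem measurableSet_Ioi] with z hz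
    filter_upwards [tendsto_inv_atTop_zero.eventually_lt_const hz, eventually_ge_atTop z]
      with M hMz hzM using ⟨hMz, hzM⟩
  refine (hcover.integral_tendsto_of_countably_generated
    (integrableOn_profileAmp hc₃ hc₄)).congr' ?_
  filter_upwards [eventually_ge_atTop 1] with M hM
  have hM₀ : 0 < M := by linarith
  have hle : M⁻¹ ≤ M := (inv_le_one_of_one_le₀ hM).trans hM
  have hsub : Ioc M⁻¹ M ⊆ Ioi 0 := fun z hz => (inv_pos.mpr hM₀).trans hz.1
  rw [intervalIntegral.integral_of_le hle, Measure.restrict_restrict measurableSet_Ioc,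
    inter_eq_left.mpr hsub]

/-! ### Sums over subsets of the support -/

theorem sum_le_sum_support {ι M : Type*} [Zero M] (b : ι →₀ M) {f : ι → ℝ} (hf : ∀ j, 0 ≤ f j)
    (hbf : ∀ j, b j = 0 → f j = 0) (s : Finset ι) : ∑ j ∈ s, f j ≤ ∑ j ∈ b.support, f j := by
  rw [← Finset.sum_filter_ne_zero]
  refine Finset.sum_le_sum_of_subset_of_nonneg (fun j hj => ?_) fun j _ _ => hf j
  exact Finsupp.mem_support_iff.mpr (mt (hbf j) (Finset.mem_filter.mp hj).2)

theorem sum_one_div_sq_le_of_separated {ι : Type*} {s : Finset ι} {u : ι → ℝ} {T : ℝ} (hT : 1 ≤ T)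
    (hsep : (s : Set ι).Pairwise fun i j => 1 ≤ |u i - u j|) (hu : ∀ i ∈ s, T ≤ u i) :
    ∑ i ∈ s, 1 / u i ^ 2 ≤ 4 / T := by
  have hT₀ : 0 ≤ T := zero_le_one.trans hT
  have hfloorT : 1 ≤ ⌊T⌋₊ := (Nat.one_le_floor_iff T).mpr hT
  have hfloor_pos : ∀ i ∈ s, 1 ≤ ⌊u i⌋₊ := fun i hi => hfloorT.trans (Nat.floor_mono (hu i hi))
  have hinj : Set.InjOn (fun i => ⌊u i⌋₊) s := fun i hi j hj hij => by
    by_contra hne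
    have hlt : ∀ k ∈ s, (⌊u k⌋₊ : ℝ) ≤ u k ∧ u k < ⌊u k⌋₊ + 1 := fun k hk =>
      ⟨Nat.floor_le (hT₀.trans (hu k hk)), Nat.lt_floor_add_one _⟩
    have hi' := hlt i hi
    rw [show ⌊u i⌋₊ = ⌊u j⌋₊ from hij] at hi'
    exact (hsep hi hj hne).not_gt (abs_sub_lt_iff.mpr (by constructor <;> linarith [hlt j hj]))
  obtain ⟨n, hn⟩ := (s.image fun i => ⌊u i⌋₊).exists_nat_subset_range
  have hsub : s.image (fun i => ⌊u i⌋₊) ⊆ Finset.Ioo (⌊T⌋₊ - 1) n := fun k hk => by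
    obtain ⟨i, hi, rfl⟩ := Finset.mem_image.mp hk
    have := Nat.floor_mono (hu i hi)
    exact Finset.mem_Ioo.mpr ⟨by omega, Finset.mem_range.mp (hn hk)⟩
  calc ∑ i ∈ s, 1 / u i ^ 2
      ≤ ∑ i ∈ s, ((⌊u i⌋₊ : ℝ) ^ 2)⁻¹ := Finset.sum_le_sum fun i hi => by
        have : (0 : ℝ) < ⌊u i⌋₊ := mod_cast hfloor_pos i hi
        rw [one_div]
        gcongr
        exact Nat.floor_le (hT₀.trans (hu i hi))
    _ = ∑ k ∈ s.image fun i => ⌊u i⌋₊, ((k : ℝ) ^ 2)⁻¹ := by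
        rw [Finset.sum_image hinj]
    _ ≤ ∑ k ∈ Finset.Ioo (⌊T⌋₊ - 1) n, ((k : ℝ) ^ 2)⁻¹ :=
        Finset.sum_le_sum_of_subset_of_nonneg hsub fun _ _ _ => by positivity
    _ ≤ 2 / ⌊T⌋₊ := by simpa [Nat.cast_sub hfloorT] using sum_Ioo_inv_sq_le (α := ℝ) (⌊T⌋₊ - 1) n
    _ ≤ 4 / T := by
        have hone : (1 : ℝ) ≤ ⌊T⌋₊ := mod_cast hfloorT
        rw [div_le_div_iff₀ (by positivity) (by positivity)]
        linarith [Nat.lt_floor_add_one T]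

theorem sum_one_div_sq_le {T x : ℝ} (hT : 1 ≤ T) (s : Finset ℤ)
    (hs : ∀ j ∈ s, T ≤ |(j : ℝ) - x|) : ∑ j ∈ s, 1 / ((j : ℝ) - x) ^ 2 ≤ 8 / T := by
  have hint : ∀ i j : ℤ, i ≠ j → (1 : ℝ) ≤ |(i : ℝ) - j| := fun i j hij => by
    exact_mod_cast Int.one_le_abs (sub_ne_zero.mpr hij)
  have hright := sum_one_div_sq_le_of_separated (s := s.filter fun j : ℤ => x ≤ j)
    (u := fun j => (j : ℝ) - x) hT (fun i _ j _ hij => by simpa using hint i j hij) fun j hj => by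
      have hmem := Finset.mem_filter.mp hj
      exact (hs j hmem.1).trans_eq (abs_of_nonneg (sub_nonneg.mpr hmem.2))
  have hleft := sum_one_div_sq_le_of_separated (s := s.filter fun j : ℤ => ¬ x ≤ j)
    (u := fun j => x - (j : ℝ)) hT (fun i _ j _ hij => by simpa using hint j i hij.symm)
    fun j hj => by
      have hmem := Finset.mem_filter.mp hj
      rw [← neg_sub, ← abs_of_neg (sub_neg.mpr (not_le.mp hmem.2))]
      exact hs j hmem.1
  simp only [sub_sq_comm x] at hleft
  rw [← Finset.sum_filter_add_sum_filter_not s fun j : ℤ => x ≤ j]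
  calc _ ≤ 4 / T + 4 / T := add_le_add hright hleft
    _ = 8 / T := by ring

theorem sum_norm_le_of_le_abs_sub {b : ℤ →₀ ℂ} {x T V : ℝ} (hT : 1 ≤ T) (s : Finset ℤ)
    (hs : ∀ j ∈ s, T ≤ |(j : ℝ) - x|)
    (hV : ∑ j ∈ b.support, ((j : ℝ) - x) ^ 2 * ‖b j‖ ^ 2 ≤ V) :
    ∑ j ∈ s, ‖b j‖ ≤ √(8 / T * V) := by
  have hsplit : ∀ j ∈ s, 1 / |(j : ℝ) - x| * (|(j : ℝ) - x| * ‖b j‖) = ‖b j‖ := fun j hj => by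
    have : 0 < |(j : ℝ) - x| := by linarith [hs j hj]
    field_simp
  have hweighted : ∑ j ∈ s, (|(j : ℝ) - x| * ‖b j‖) ^ 2 ≤ V := by
    simp only [mul_pow, sq_abs]
    exact (sum_le_sum_support b (fun j => by positivity) (fun j hj => by simp [hj]) s).trans hV
  have hinv : ∑ j ∈ s, (1 / |(j : ℝ) - x|) ^ 2 ≤ 8 / T := by
    simpa only [div_pow, one_pow, sq_abs] using sum_one_div_sq_le hT s hs
  calc ∑ j ∈ s, ‖b j‖
      = ∑ j ∈ s, 1 / |(j : ℝ) - x| * (|(j : ℝ) - x| * ‖b j‖) :=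
        (Finset.sum_congr rfl hsplit).symm
    _ ≤ √(∑ j ∈ s, (1 / |(j : ℝ) - x|) ^ 2) * √(∑ j ∈ s, (|(j : ℝ) - x| * ‖b j‖) ^ 2) :=
        Real.sum_mul_le_sqrt_mul_sqrt _ _ _
    _ ≤ √(8 / T) * √V := by gcongr
    _ = √(8 / T * V) := (Real.sqrt_mul (by positivity) V).symm

/-! ### The `ℓ¹` norm of a sequence with dispersive estimates -/

/-- The estimates satisfied by the coefficients `b` of an `n`-th convolution power at the scale
`l = n ^ (1 / 4)`, centred at the transported position `x = α * n`. The asymptotics of the `ℓ¹`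
norm are a consequence of these three bounds with a constant `D` independent of `n`. -/
structure DispersiveBounds (c₃ c₄ D : ℝ) (b : ℤ →₀ ℂ) (l x : ℝ) : Prop where
  sum_sq_le : ∑ j ∈ b.support, ‖b j‖ ^ 2 ≤ D / l
  sum_weighted_sq_le : ∑ j ∈ b.support, ((j : ℝ) - x) ^ 2 * ‖b j‖ ^ 2 ≤ D * l ^ 3
  norm_sub_oscInt_le : ∀ j : ℤ,
    ‖b j - (2 * π * l : ℝ)⁻¹ * oscInt c₃ c₄ l ((x - j) / l ^ 2)‖ ≤ D / l ^ 2

theorem DispersiveAssumption.exists_dispersiveBounds {a : ℤ →₀ ℂ} {α c₃ c₄ : ℝ}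
    (ha : DispersiveAssumption a α c₃ c₄) : ∃ D, ∀ (n : ℕ) (l : ℝ), 2 ≤ n → 0 < l →
      l ^ 4 = n → DispersiveBounds c₃ c₄ D (convPow a n) l (α * n) := by
  obtain ⟨c, hc, hcc₄, hdecay⟩ := ha.exists_norm_fourierSymbol_le
  obtain ⟨C, hC, hmodel⟩ := exists_norm_le_mul_abs_pow_of_isBigO
    ((continuous_fourierSymbol a).sub (continuous_modelSymbol α c₃ c₄)) ha.isBigO_sub_modelSymbol
  obtain ⟨C', -, hweight⟩ := exists_norm_le_mul_abs_pow_of_isBigO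
    (continuous_fourierSymbol (weightedSeq a α)) ha.isBigO_weightedSeq
  set D₁ := (2 * π)⁻¹ * quarticMoment c 0
  set D₂ := (2 * π)⁻¹ * (C' ^ 2 * quarticMoment (c / 2) 4)
  set D₃ := (2 * π)⁻¹ * ((C + 1) * quarticMoment (c / 2) 5)
  have hD₁ : D₁ ≤ max D₁ (max D₂ D₃) := le_max_left _ _
  have hD₂ : D₂ ≤ max D₁ (max D₂ D₃) := (le_max_left _ _).trans (le_max_right _ _)
  have hD₃ : D₃ ≤ max D₁ (max D₂ D₃) := (le_max_right _ _).trans (le_max_right _ _)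
  refine ⟨max D₁ (max D₂ D₃), fun n l hn hl₀ hl => ⟨?_, ?_, fun j => ?_⟩⟩
  · calc _ ≤ (2 * π)⁻¹ * (quarticMoment c 0 / l) := sum_norm_sq_convPow_le hc hdecay hl₀ hl
      _ = D₁ / l := (mul_div_assoc _ _ _).symm
      _ ≤ _ := by gcongr
  · calc _ ≤ (2 * π)⁻¹ * (C' ^ 2 * quarticMoment (c / 2) 4 * l ^ 3) :=
          sum_sq_mul_norm_sq_convPow_le hc hdecay hweight hn hl₀ hl
      _ = D₂ * l ^ 3 := (mul_assoc _ _ _).symm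
      _ ≤ _ := by gcongr
  · calc _ ≤ (2 * π)⁻¹ * ((C + 1) * quarticMoment (c / 2) 5 / l ^ 2) :=
          norm_convPow_sub_oscInt_le hc hcc₄ hC hdecay hmodel hn hl₀ hl j
      _ = D₃ / l ^ 2 := (mul_div_assoc _ _ _).symm
      _ ≤ _ := by gcongr

namespace DispersiveBounds

variable {c₃ c₄ D e M l x η : ℝ} {b : ℤ →₀ ℂ}

theorem nonneg (hb : DispersiveBounds c₃ c₄ D b l x) (hl : 0 < l) : 0 ≤ D := by
  have hDl : 0 ≤ D / l := (Finset.sum_nonneg fun _ _ => by positivity).trans hb.sum_sq_le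
  simpa [hl.ne'] using mul_nonneg hDl hl.le

theorem abs_norm_sub_oscInt_le (hb : DispersiveBounds c₃ c₄ D b l x) (hl : 0 < l) (j : ℤ) :
    |‖b j‖ - (2 * π * l)⁻¹ * ‖oscInt c₃ c₄ l ((x - j) / l ^ 2)‖| ≤ D / l ^ 2 := by
  have hle := (abs_norm_sub_norm_le _ _).trans (hb.norm_sub_oscInt_le j)
  rwa [norm_mul, Complex.norm_real, Real.norm_of_nonneg (by positivity)] at hle

theorem abs_mul_norm_sub_le (hb : DispersiveBounds c₃ c₄ D b l x) (hl : 0 < l) {j : ℤ} {g : ℝ}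
    (hg : |√l * ‖oscInt c₃ c₄ l ((x - j) / l ^ 2)‖ - g| ≤ η) :
    |l * √l * ‖b j‖ - (2 * π)⁻¹ * g| ≤ D / √l + η := by
  set I : ℝ := ‖oscInt c₃ c₄ l ((x - j) / l ^ 2)‖
  have hcoeff : |l * √l * ‖b j‖ - (2 * π)⁻¹ * (√l * I)| ≤ D / √l := by
    calc |l * √l * ‖b j‖ - (2 * π)⁻¹ * (√l * I)|
        = l * √l * |‖b j‖ - (2 * π * l)⁻¹ * I| := by
          rw [← abs_of_pos (by positivity : 0 < l * √l), ← abs_mul,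
            abs_of_pos (by positivity : 0 < l * √l)]
          congr 1
          field_simp
      _ ≤ l * √l * (D / l ^ 2) := by gcongr; exact hb.abs_norm_sub_oscInt_le hl j
      _ = D / √l := by
          field_simp
          rw [Real.sq_sqrt hl.le]
  have hosc : |(2 * π)⁻¹ * (√l * I) - (2 * π)⁻¹ * g| ≤ η := by
    rw [← mul_sub, abs_mul, abs_of_pos (by positivity)]
    have : (2 * π)⁻¹ ≤ 1 := inv_le_one_of_one_le₀ (by linarith [Real.pi_gt_three])
    exact (mul_le_of_le_one_left (abs_nonneg _) this).trans hg
  exact (abs_sub_le _ _ _).trans (add_le_add hcoeff hosc)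

theorem abs_sum_window_sub_le (hb : DispersiveBounds c₃ c₄ D b l x) (hl : 1 ≤ l) (heM : e ≤ M)
    (hη : 0 ≤ η)
    (hosc : ∀ z ∈ Icc e M, |√l * ‖oscInt c₃ c₄ l z‖ - oscProfile c₃ c₄ l z| ≤ η) :
    |(∑ j ∈ scaledWindow x (l ^ 2) e M, ‖b j‖) / √l - (2 * π)⁻¹ *
        ((∑ j ∈ scaledWindow x (l ^ 2) e M, oscProfile c₃ c₄ l ((x - j) / l ^ 2)) / l ^ 2)| ≤
      (M - e + 1) * (D / √l + η) := by
  have hl₀ : 0 < l := by linarith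
  have hD : 0 ≤ D := hb.nonneg hl₀
  have hl₁ : 1 ≤ l ^ 2 := one_le_pow₀ hl
  set J := scaledWindow x (l ^ 2) e M
  set g : ℤ → ℝ := fun j => oscProfile c₃ c₄ l ((x - j) / l ^ 2)
  have hcard : (J.card : ℝ) ≤ (M - e + 1) * l ^ 2 := by
    linarith [card_scaledWindow_le (x := x) (r := l ^ 2) (by positivity) heM]
  have hsum : |∑ j ∈ J, (l * √l * ‖b j‖ - (2 * π)⁻¹ * g j)| ≤ J.card * (D / √l + η) := by
    rw [← nsmul_eq_mul, ← Finset.sum_const]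
    refine (Finset.abs_sum_le_sum_abs _ _).trans (Finset.sum_le_sum fun j hj => ?_)
    exact hb.abs_mul_norm_sub_le hl₀ (hosc _ ((mem_scaledWindow (by positivity)).mp hj))
  calc |(∑ j ∈ J, ‖b j‖) / √l - (2 * π)⁻¹ * ((∑ j ∈ J, g j) / l ^ 2)|
      = |∑ j ∈ J, (l * √l * ‖b j‖ - (2 * π)⁻¹ * g j)| / l ^ 2 := by
        rw [← abs_of_pos (by positivity : 0 < l ^ 2), ← abs_div,
          abs_of_pos (by positivity : 0 < l ^ 2), Finset.sum_sub_distrib, ← Finset.mul_sum,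
          ← Finset.mul_sum]
        congr 1
        have hsq : √l * √l = l := Real.mul_self_sqrt hl₀.le
        field_simp
        linear_combination (-(∑ j ∈ J, ‖b j‖) * 2 * π * l) * hsq
    _ ≤ (M - e + 1) * l ^ 2 * (D / √l + η) / l ^ 2 := by
        gcongr
        exact hsum.trans (by gcongr)
    _ = (M - e + 1) * (D / √l + η) := by field_simp

-- To the left of the wave front the phase has no stationary point, so `b` is `O(l ^ (-2))` there.
theorem sum_left_le (hb : DispersiveBounds c₃ c₄ D b l x) (hc₃ : 0 ≤ c₃) (hc₄ : 0 < c₄)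
    (he : 0 < e) (heM : e ≤ M) (hl : 1 ≤ l) :
    ∑ j ∈ scaledWindow x (l ^ 2) (-M) (-e), ‖b j‖ ≤ (M - e + 1) * (10 / e + D) := by
  have hl₀ : 0 < l := by linarith
  have hD : 0 ≤ D := hb.nonneg hl₀
  have hl₁ : 1 ≤ l ^ 2 := one_le_pow₀ hl
  have hcoeff : ∀ j ∈ scaledWindow x (l ^ 2) (-M) (-e), ‖b j‖ ≤ (10 / e + D) / l ^ 2 := by
    intro j hj
    have hz : (x - j) / l ^ 2 ≤ -e := ((mem_scaledWindow (by positivity)).mp hj).2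
    have hosc : ‖oscInt c₃ c₄ l ((x - j) / l ^ 2)‖ ≤ 10 / (l * e) :=
      (norm_oscInt_le_of_neg hc₃ hc₄ hl₀ (by linarith)).trans (by gcongr; linarith)
    have hpi : (2 * π * l)⁻¹ ≤ l⁻¹ := by
      gcongr
      nlinarith [Real.pi_gt_three]
    calc ‖b j‖ ≤ (2 * π * l)⁻¹ * ‖oscInt c₃ c₄ l ((x - j) / l ^ 2)‖ + D / l ^ 2 :=
          sub_le_iff_le_add'.mp (le_of_abs_le (hb.abs_norm_sub_oscInt_le hl₀ j))
      _ ≤ l⁻¹ * (10 / (l * e)) + D / l ^ 2 := by gcongr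
      _ = (10 / e + D) / l ^ 2 := by field_simp
  have hcard : ((scaledWindow x (l ^ 2) (-M) (-e)).card : ℝ) ≤ (M - e + 1) * l ^ 2 := by
    linarith [card_scaledWindow_le (x := x) (r := l ^ 2) (by positivity) (neg_le_neg heM)]
  calc ∑ j ∈ scaledWindow x (l ^ 2) (-M) (-e), ‖b j‖
      ≤ (scaledWindow x (l ^ 2) (-M) (-e)).card * ((10 / e + D) / l ^ 2) := by
        rw [← nsmul_eq_mul, ← Finset.sum_const]
        exact Finset.sum_le_sum hcoeff
    _ ≤ (M - e + 1) * l ^ 2 * ((10 / e + D) / l ^ 2) := by gcongr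
    _ = (M - e + 1) * (10 / e + D) := by field_simp

theorem sum_near_le (hb : DispersiveBounds c₃ c₄ D b l x) (he : 0 < e) (hl : 0 < l)
    (hle : 1 ≤ e * l ^ 2) :
    ∑ j ∈ scaledWindow x (l ^ 2) (-e) e, ‖b j‖ ≤ √(3 * e * D) * √l := by
  have hD : 0 ≤ D := hb.nonneg hl
  set J := scaledWindow x (l ^ 2) (-e) e
  have hcard : (J.card : ℝ) ≤ 3 * e * l ^ 2 := by
    linarith [card_scaledWindow_le (x := x) (r := l ^ 2) (by positivity) (neg_le_self he.le)]
  have hsq : ∑ j ∈ J, ‖b j‖ ^ 2 ≤ D / l :=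
    (sum_le_sum_support b (fun j => by positivity) (fun j hj => by simp [hj]) J).trans hb.sum_sq_le
  calc ∑ j ∈ J, ‖b j‖
      ≤ √(J.card * ∑ j ∈ J, ‖b j‖ ^ 2) := Real.le_sqrt_of_sq_le sq_sum_le_card_mul_sum_sq
    _ ≤ √(3 * e * l ^ 2 * (D / l)) := by gcongr
    _ = √(3 * e * D) * √l := by
        rw [← Real.sqrt_mul (by positivity)]
        congr 1
        field_simp

theorem sum_far_le (hb : DispersiveBounds c₃ c₄ D b l x) (hM : 0 < M) (hl : 0 < l)
    (hlM : 1 ≤ M * l ^ 2) :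
    ∑ j ∈ b.support.filter fun j : ℤ => M ≤ |(x - j) / l ^ 2|, ‖b j‖ ≤ √(8 / M * D) * √l := by
  have hdist : ∀ j ∈ b.support.filter fun j : ℤ => M ≤ |(x - j) / l ^ 2|,
      M * l ^ 2 ≤ |(j : ℝ) - x| := fun j hj => by
    have hfar := (Finset.mem_filter.mp hj).2
    rwa [abs_div, abs_of_pos (by positivity : 0 < l ^ 2), le_div_iff₀ (by positivity),
      abs_sub_comm] at hfar
  refine (sum_norm_le_of_le_abs_sub hlM _ hdist hb.sum_weighted_sq_le).trans_eq ?_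
  rw [← Real.sqrt_mul' _ hl.le]
  congr 1
  field_simp

theorem sum_support_le (b : ℤ →₀ ℂ) (hl : 0 < l) (x e M : ℝ) :
    ∑ j ∈ b.support, ‖b j‖ ≤ ∑ j ∈ scaledWindow x (l ^ 2) e M, ‖b j‖ +
      ∑ j ∈ scaledWindow x (l ^ 2) (-M) (-e), ‖b j‖ + ∑ j ∈ scaledWindow x (l ^ 2) (-e) e, ‖b j‖ +
      ∑ j ∈ b.support.filter fun j : ℤ => M ≤ |(x - j) / l ^ 2|, ‖b j‖ := by
  set J := scaledWindow x (l ^ 2) e M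
  set J₁ := scaledWindow x (l ^ 2) (-M) (-e)
  set J₂ := scaledWindow x (l ^ 2) (-e) e
  set J₃ := b.support.filter fun j : ℤ => M ≤ |(x - j) / l ^ 2|
  have hunion : ∀ s t : Finset ℤ, ∑ j ∈ s ∪ t, ‖b j‖ ≤ ∑ j ∈ s, ‖b j‖ + ∑ j ∈ t, ‖b j‖ := by
    intro s t
    rw [← Finset.sum_union_inter]
    exact le_add_of_nonneg_right (Finset.sum_nonneg fun _ _ => norm_nonneg _)
  have hcover : b.support ⊆ J ∪ J₁ ∪ J₂ ∪ J₃ := fun j hj => by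
    simp only [J, J₁, J₂, J₃, Finset.mem_union, Finset.mem_filter,
      mem_scaledWindow (pow_pos hl 2), mem_Icc]
    grind
  calc ∑ j ∈ b.support, ‖b j‖ ≤ ∑ j ∈ J ∪ J₁ ∪ J₂ ∪ J₃, ‖b j‖ :=
        Finset.sum_le_sum_of_subset_of_nonneg hcover fun _ _ _ => norm_nonneg _
    _ ≤ _ := by linarith [hunion (J ∪ J₁ ∪ J₂) J₃, hunion (J ∪ J₁) J₂, hunion J J₁]

theorem abs_sum_support_sub_sum_window_le (hb : DispersiveBounds c₃ c₄ D b l x) (hc₃ : 0 ≤ c₃)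
    (hc₄ : 0 < c₄) (he : 0 < e) (heM : e ≤ M) (hl : 1 ≤ l) (hle : 1 ≤ e * l ^ 2) :
    |(∑ j ∈ b.support, ‖b j‖) / √l - (∑ j ∈ scaledWindow x (l ^ 2) e M, ‖b j‖) / √l| ≤
      (M - e + 1) * (10 / e + D) / √l + (√(3 * e * D) + √(8 / M * D)) := by
  have hl₀ : 0 < l := by linarith
  have hwindow := sum_le_sum_support b (fun j => norm_nonneg (b j)) (fun j hj => by simp [hj])
    (scaledWindow x (l ^ 2) e M)
  rw [← sub_div, abs_of_nonneg (div_nonneg (sub_nonneg.mpr hwindow) (Real.sqrt_nonneg l)),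
    ← mul_div_cancel_right₀ (√(3 * e * D) + √(8 / M * D)) (Real.sqrt_pos.mpr hl₀).ne', ← add_div]
  gcongr
  have hleft := hb.sum_left_le hc₃ hc₄ he heM hl
  have hnear := hb.sum_near_le he hl₀ hle
  have hfar := hb.sum_far_le (he.trans_le heM) hl₀ (hle.trans (by gcongr))
  linarith [sum_support_le b hl₀ x e M]

end DispersiveBounds

theorem tendsto_of_forall_eventually_abs_sub_le {ι : Type*} {p : Filter ι} {f : ι → ℝ}
    {g : ℝ → ι → ℝ} {G ρ : ℝ → ℝ} {L : ℝ} (hg : ∀ᶠ M in atTop, Tendsto (g M) p (𝓝 (G M)))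
    (hG : Tendsto G atTop (𝓝 L)) (hρ : Tendsto ρ atTop (𝓝 0))
    (hfg : ∀ᶠ M in atTop, ∀ᶠ i in p, |f i - g M i| ≤ ρ M) : Tendsto f p (𝓝 L) := by
  rw [Metric.tendsto_nhds]
  intro ε hε
  have hε₃ : 0 < ε / 3 := by positivity
  obtain ⟨M, hgM, hfM, hρM, hGM⟩ := (hg.and (hfg.and ((hρ.eventually_lt_const hε₃).and
    (Metric.tendsto_nhds.mp hG _ hε₃)))).exists
  filter_upwards [hfM, Metric.tendsto_nhds.mp hgM _ hε₃] with i hfi hgi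
  calc dist (f i) L
      ≤ dist (f i) (g M i) + dist (g M i) (G M) + dist (G M) L := dist_triangle4 _ _ _ _
    _ < ε / 3 + ε / 3 + ε / 3 := by
        gcongr
        exact hfi.trans_lt hρM
    _ = ε := by ring

section

variable {ι : Type*} {p : Filter ι} {c₃ c₄ D e M : ℝ} {b : ι → ℤ →₀ ℂ} {l x : ι → ℝ}

theorem tendsto_sum_oscProfile (hc₃ : 0 < c₃) (c₄ : ℝ) (he : 0 < e) (heM : e < M)
    (hl : Tendsto l p atTop) (x : ι → ℝ) :
    Tendsto (fun i => (∑ j ∈ scaledWindow (x i) (l i ^ 2) e M,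
      oscProfile c₃ c₄ (l i) ((x i - j) / l i ^ 2)) / l i ^ 2) p
      (𝓝 (2 / π * ∫ z in e..M, profileAmp c₃ c₄ z)) := by
  obtain ⟨K, hK⟩ := exists_abs_sum_oscProfile_sub_le hc₃ c₄ he heM
  refine tendsto_iff_dist_tendsto_zero.mpr (squeeze_zero' (.of_forall fun _ => dist_nonneg)
    ((hl.eventually hK).mono fun i hi => hi (x i)) (hl.const_div_atTop K))

theorem tendsto_sum_window_div_sqrt (hc₃ : 0 < c₃) (hc₄ : 0 < c₄) (he : 0 < e) (heM : e < M)
    (hl : Tendsto l p atTop) (hb : ∀ᶠ i in p, DispersiveBounds c₃ c₄ D (b i) (l i) (x i)) :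
    Tendsto (fun i => (∑ j ∈ scaledWindow (x i) (l i ^ 2) e M, ‖b i j‖) / √(l i)) p
      (𝓝 ((2 * π)⁻¹ * (2 / π * ∫ z in e..M, profileAmp c₃ c₄ z))) := by
  obtain ⟨K, hK⟩ := exists_abs_sqrt_mul_norm_oscInt_sub_le hc₃ hc₄ he M
  have herror : Tendsto (fun i => (M - e + 1) * (D / √(l i) + K * l i ^ (-(1 / 10) : ℝ))) p
      (𝓝 0) := by
    have hsqrt := (Real.tendsto_sqrt_atTop.comp hl).const_div_atTop D
    have hrpow := ((tendsto_rpow_neg_atTop (by norm_num : (0 : ℝ) < 1 / 10)).comp hl).const_mul K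
    simpa using (hsqrt.add hrpow).const_mul (M - e + 1)
  refine tendsto_of_tendsto_of_dist
    ((tendsto_sum_oscProfile hc₃ c₄ he heM hl x).const_mul (2 * π)⁻¹)
    (squeeze_zero' (.of_forall fun _ => dist_nonneg) ?_ herror)
  filter_upwards [hb, hl.eventually hK, hl.eventually_ge_atTop 1] with i hbi hKi hli
  rw [dist_comm]
  exact hbi.abs_sum_window_sub_le hli heM.le
    ((abs_nonneg _).trans (hKi e (left_mem_Icc.mpr heM.le))) hKi

theorem tendsto_sum_norm_div_sqrt (hc₃ : 0 < c₃) (hc₄ : 0 < c₄) (hl : Tendsto l p atTop)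
    (hb : ∀ᶠ i in p, DispersiveBounds c₃ c₄ D (b i) (l i) (x i)) :
    Tendsto (fun i => (∑ j ∈ (b i).support, ‖b i j‖) / √(l i)) p
      (𝓝 ((2 * π)⁻¹ * (2 / π * ∫ z in Ioi 0, profileAmp c₃ c₄ z))) := by
  have hsqrt : Tendsto (fun M : ℝ => √(3 * M⁻¹ * D) + √(8 / M * D)) atTop (𝓝 0) := by
    have hnear := ((tendsto_inv_atTop_zero.const_mul (3 : ℝ)).mul_const D).sqrt
    have hfar := ((tendsto_id.const_div_atTop (8 : ℝ)).mul_const D).sqrt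
    simpa using hnear.add hfar
  have hrest : Tendsto (fun M : ℝ => M⁻¹ + (√(3 * M⁻¹ * D) + √(8 / M * D))) atTop (𝓝 0) := by
    simpa using tendsto_inv_atTop_zero.add hsqrt
  have hlt : ∀ {M : ℝ}, 1 < M → M⁻¹ < M := fun hM => (inv_lt_one_of_one_lt₀ hM).trans hM
  refine tendsto_of_forall_eventually_abs_sub_le
    (g := fun M i => (∑ j ∈ scaledWindow (x i) (l i ^ 2) M⁻¹ M, ‖b i j‖) / √(l i)) ?_
    (((tendsto_integral_profileAmp hc₃ hc₄).const_mul (2 / π)).const_mul (2 * π)⁻¹) hrest ?_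
  · filter_upwards [eventually_gt_atTop 1] with M hM
    exact tendsto_sum_window_div_sqrt hc₃ hc₄ (by positivity) (hlt hM) hl hb
  · filter_upwards [eventually_gt_atTop 1] with M hM
    have he : 0 < M⁻¹ := by positivity
    have hleft := (Real.tendsto_sqrt_atTop.comp hl).const_div_atTop
      ((M - M⁻¹ + 1) * (10 / M⁻¹ + D))
    have hscale := ((tendsto_pow_atTop two_ne_zero).comp hl).const_mul_atTop he
    filter_upwards [hb, hl.eventually_ge_atTop 1, hscale.eventually_ge_atTop 1,
      hleft.eventually_le_const he] with i hbi hli hei hlefti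
    exact (hbi.abs_sum_support_sub_sum_window_le hc₃.le hc₄ he (hlt hM).le hli hei).trans
      (add_le_add_left hlefti _)

end

theorem tendsto_sum_norm_convPow {a : ℤ →₀ ℂ} {α c₃ c₄ : ℝ}
    (ha : DispersiveAssumption a α c₃ c₄) (hc₃ : 0 < c₃) :
    Tendsto (fun n : ℕ => 1 / (n : ℝ) ^ (1 / 8 : ℝ) *
        ∑ j ∈ (convPow a n).support, ‖convPow a n j‖) atTop
      (𝓝 (8 * Real.Gamma (11 / 8) / (√3 * π ^ (3 / 2 : ℝ)) *
        (c₃ ^ (1 / 2 : ℝ) / c₄ ^ (3 / 8 : ℝ)))) := by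
  obtain ⟨D, hD⟩ := ha.exists_dispersiveBounds
  have hscale : Tendsto (fun n : ℕ => (n : ℝ) ^ (1 / 4 : ℝ)) atTop atTop :=
    (tendsto_rpow_atTop (by norm_num)).comp tendsto_natCast_atTop_atTop
  have hbounds : ∀ᶠ n : ℕ in atTop,
      DispersiveBounds c₃ c₄ D (convPow a n) ((n : ℝ) ^ (1 / 4 : ℝ)) (α * n) := by
    filter_upwards [eventually_ge_atTop 2] with n hn
    refine hD n _ hn (by positivity) ?_
    rw [← Real.rpow_mul_natCast n.cast_nonneg]
    norm_num
  have hroot : ∀ n : ℕ, √((n : ℝ) ^ (1 / 4 : ℝ)) = (n : ℝ) ^ (1 / 8 : ℝ) := fun n => by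
    rw [Real.sqrt_eq_rpow, ← Real.rpow_mul n.cast_nonneg]
    norm_num
  rw [← two_div_pi_mul_integral_profileAmp hc₃ ha.c₄_pos]
  simpa only [hroot, one_div_mul_eq_div] using
    tendsto_sum_norm_div_sqrt hc₃ ha.c₄_pos hscale hbounds

end

theorem corollary2 (a : ℤ →₀ ℂ) (α c₃ c₄ : ℝ) (ha : DispersiveAssumption a α c₃ c₄)
    (hc₃ : 0 < c₃) :
    (∀ n : ℕ, Summable fun j : ℤ => ‖greenFunction a n j‖) ∧
    Filter.Tendsto
      (fun n : ℕ => 1 / (n : ℝ) ^ (1 / 8 : ℝ) * ∑' j : ℤ, ‖greenFunction a n j‖)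
      Filter.atTop
      (nhds (8 * Real.Gamma (11 / 8) / (√3 * Real.pi ^ (3 / 2 : ℝ)) *
        (c₃ ^ (1 / 2 : ℝ) / c₄ ^ (3 / 8 : ℝ)))) ∧
    Filter.Tendsto
      (fun n : ℕ => 1 / (n : ℝ) ^ (1 / 8 : ℝ) * ‖laurentLinfty a ^ n‖)
      Filter.atTop
      (nhds (8 * Real.Gamma (11 / 8) / (√3 * Real.pi ^ (3 / 2 : ℝ)) *
        (c₃ ^ (1 / 2 : ℝ) / c₄ ^ (3 / 8 : ℝ)))) := by
  have h := tendsto_sum_norm_convPow ha hc₃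
  refine ⟨summable_norm_greenFunction a, ?_, ?_⟩
  · simpa only [tsum_norm_greenFunction] using h
  · simpa only [laurentLinfty_pow, norm_laurentLinfty] using h
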